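/- Let $f:[-1,1]\to\mathbb C$ be in $L^\infty([-1,1])$ (Lebesgue measure), and let $\|f\|_p$ denote the norm in $L^p([-1,1])$. Put $\hat f(z)=\int_{-1}^1 e^{-izt}f(t)\,dt$ for $z\in\mathbb C$, let $\|\hat f\|_q$ denote the $L^q(\mathbb R)$ norm of the restriction of $\hat f$ to $\mathbb R$, and put $\Omega_f(s)=\int_0^s\int_0^{\sigma_2}\hat f(\sigma_1)\,d\sigma_1\,d\sigma_2$ for $s\in\mathbb R$. For $z\in\mathbb C$ let $v_z(t)=(1-izt-e^{-izt})/t^2$ for $t\neq0$ and $v_z(0)=z^2/2$. Then: (a) $\|\hat f\|_\infty\le\|f\|_1$. (b) For each $1\le p\le 2$, with $q$ defined by $1/p+1/q=1$ (so $q=\infty$ if $p=1$), one has $f\in L^p([-1,1])$ and $\|\hat f\|_q\le C_p\|f\|_p$, where $C_p=(2\pi)^{1/q}\bigl(p^{1/p}/q^{1/q}\bigr)^{1/2}$ (with $C_1=1$) is the sharp Hausdorff--Young--Babenko--Beckner constant on $\mathbb R$ for the transform $\int_{\mathbb R} e^{-ist}g(t)\,dt$. (c) $\hat f(s)\to0$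 as $|s|\to\infty$, $s\in\mathbb R$. (d) $\hat f$ is analytic on $\mathbb C$. (e) $\Omega_f(s)=\int_{-1}^1 v_s(t)f(t)\,dt$ for every $s\in\mathbb R$. The function $z\mapsto\int_{-1}^1 v_z(t)f(t)\,dt$, which therefore extends $\Omega_f$ to $\mathbb C$, is analytic on $\mathbb C$ and its second derivative is $\hat f$ on $\mathbb C$. On $\mathbb R$, $\Omega_f$ is twice differentiable and $\Omega_f''(s)=\hat f(s)$ for every $s\in\mathbb R$. (f) $\Omega_f(s)=O(s\log|s|)$ as $|s|\to\infty$, $s\in\mathbb R$. This is sharp: there is $f\in L^\infty([-1,1])$ such that $\Omega_f(s)$ is not $o(s\log|s|)$ as $|s|\to\infty$. (g) For all $s,h\in\mathbb R$, $$|\Omega_f(s+h)-\Omega_f(s)|\le\begin{cases}\|f\|_\infty\,(2|h||s|+h^2), & |s|\le 1,\\ \|f\|_\infty\,(2|h|+4|h|\log|s|+h^2), & |s|\ge1.\end{cases}$$ -/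

import Mathlib

open MeasureTheory Filter Topology Asymptotics
open scoped ENNReal

noncomputable section

namespace BoundedFourier

/-- Lebesgue measure on the interval `[-1, 1]`; the spaces `L^p([-1, 1])` are taken with respect to
this measure. -/
abbrev intervalMeasure : Measure ℝ := volume.restrict (Set.Icc (-1 : ℝ) 1)

/-- The Fourier transform `∫_{-1}^1 e^{-izt} f(t) dt` of a function on `[-1, 1]`, as a function of
the complex variable `z`; the Fourier transform on the real line is its restriction. -/
def fhat (f : ℝ → ℂ) (z : ℂ) : ℂ :=
  ∫ t in (-1 : ℝ)..1, Complex.exp (-Complex.I * z * (t : ℂ)) * f t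

/-- The double primitive `∫_0^s ∫_0^{σ₂} fhat(σ₁) dσ₁ dσ₂`, for real `s`. -/
def Omega (f : ℝ → ℂ) (s : ℝ) : ℂ :=
  ∫ σ₂ in (0 : ℝ)..s, ∫ σ₁ in (0 : ℝ)..σ₂, fhat f (σ₁ : ℂ)

/-- The kernel `v_z(t) = (1 - izt - e^{-izt}) / t²`, with `v_z(0) = z²/2`. -/
def v (z : ℂ) (t : ℝ) : ℂ :=
  if t = 0 then z ^ 2 / 2
  else (1 - Complex.I * z * (t : ℂ) - Complex.exp (-Complex.I * z * (t : ℂ))) / (t : ℂ) ^ 2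

/-- The sharp constant `(2π)^{1/q} (p^{1/p} / q^{1/q})^{1/2}`, `1/p + 1/q = 1`, of the
Hausdorff-Young-Babenko-Beckner inequality on the real line for the transform with kernel
`e^{-ist}`. It is written with `1/q = 1 - 1/p`, so that `p = 1` (where `0 ^ 0 = 1`) is covered. -/
def hausdorffYoungConst (p : ℝ) : ℝ :=
  (2 * Real.pi) ^ (1 - 1 / p) *
    (p ^ (1 / p) * (1 - 1 / p) ^ (1 - 1 / p)) ^ (1 / 2 : ℝ)

theorem hausdorffYoungConst_one : hausdorffYoungConst 1 = 1 := by
  simp [hausdorffYoungConst]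

theorem hausdorffYoungConst_eq {p q : ℝ} (hp : 1 < p) (hpq : 1 / p + 1 / q = 1) :
    hausdorffYoungConst p =
      (2 * Real.pi) ^ (1 / q) * (p ^ (1 / p) / q ^ (1 / q)) ^ (1 / 2 : ℝ) := by
  have h : 1 - 1 / p = 1 / q := by linarith
  have hp1 : 1 / p < 1 := by rw [div_lt_one (by linarith)]; exact hp
  have hq : 0 < q := by
    have : 0 < 1 / q := by linarith
    exact one_div_pos.mp this
  rw [hausdorffYoungConst, h]
  congr 2
  rw [one_div q, Real.inv_rpow hq.le, ← div_eq_mul_inv]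

end BoundedFourier

end

noncomputable section

namespace BoundedFourier

open ProbabilityTheory ComplexConjugate

/-! The hard part is the sharp Hausdorff–Young inequality for 1 < p ≤ 2. It comes from complex
Gaussian hypercontractivity. With κ² = p − 1 = 1/(q − 1), take the exponential sum w = ∑ c_j
exp(iθ_j z − θ_j² r) at z = ξ sin α + iκη cos α and r = (1 + κ²)/2 · cos² α, where ξ and η are
independent standard Gaussians. The time r is tuned so that the Gaussian mean of w does not depend
on α. At α = 0 only η survives and at α = π/2 only ξ, so G(α) = E_ξ (E_η |w|^q)^{p/q} interpolates
between the two sides of the inequality, and it suffices that G increases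
(`flowG_zero_le_flowG_pi_div_two`).

After Gaussian integration by parts in both variables, the terms in the second derived sum cancel.
The sign of G′ then rests on a pointwise convexity inequality for |w|^q (`powDeriv₂_I_mul_sub_ge`),
where conjugacy of p and q removes one term exactly, followed by Cauchy–Schwarz in η
(`flowM_sq_le`). Replacing |w|² by |w|² + ε keeps every power smooth and bounded away from zero; ε
goes to 0 afterwards.

Multiplying an exponential sum by exp(−x²/2p) turns Gaussian norms into Lebesgue norms. The Fourier
transform of the product is a Gaussian times the same sum at time p/2 on the imaginary axis
(`lineFourier_dampedSum`), so hypercontractivity becomes Hausdorff–Young with exactly the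
Babenko–Beckner constant. Trigonometric approximation, mollification and Fatou extend it to bounded
functions supported in [−1, 1].

The rest is calculus with the kernel v. Its z-derivatives are v′ and e^{−izt}, so differentiation
under the integral gives the entire extension, and integrating twice from 0 identifies it with Ω_f.
For real s, |v′_s(t)| ≤ min(|s|, 2/|t|); splitting the integral at |t| = 1/|s| produces the
logarithm. For the sign function, sin x ≤ x rules out cancellation in Im v, so the growth s log s is
attained. -/

/-- The standard Gaussian measure on the line. -/
abbrev gauss : Measure ℝ := gaussianReal 0 1

/-! ### Gaussian moments and Gaussian integration by parts -/

lemma integrable_exp_mul_abs_gauss (b : ℝ) : Integrable (fun x : ℝ => Real.exp (b * |x|)) gauss := by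
  refine ((integrable_exp_mul_gaussianReal (μ := 0) (v := 1) b).add
    (integrable_exp_mul_gaussianReal (μ := 0) (v := 1) (-b))).mono'
    (by fun_prop) (Eventually.of_forall fun x => ?_)
  rw [Real.norm_eq_abs, abs_of_pos (Real.exp_pos _)]
  rcases abs_cases x with ⟨h, _⟩ | ⟨h, _⟩ <;> rw [h]
  · exact le_add_of_nonneg_right (Real.exp_pos _).le
  · rw [mul_neg, ← neg_mul]
    exact le_add_of_nonneg_left (Real.exp_pos _).le

lemma integrable_one_add_abs_mul_exp_gauss (b : ℝ) :
    Integrable (fun x : ℝ => (1 + |x|) * Real.exp (b * |x|)) gauss := by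
  refine (integrable_exp_mul_abs_gauss (1 + b)).mono' (by fun_prop)
    (Eventually.of_forall fun x => ?_)
  rw [Real.norm_eq_abs, abs_of_nonneg (by positivity), add_mul 1 b, Real.exp_add, one_mul]
  gcongr
  linarith [Real.add_one_le_exp |x|]

lemma integrable_abs_gauss : Integrable (fun x : ℝ => |x|) gauss :=
  (integrable_one_add_abs_mul_exp_gauss 0).mono' (by fun_prop)
    (Eventually.of_forall fun x => by simp)

lemma gaussianPDFReal_zero_one (x : ℝ) :
    gaussianPDFReal 0 1 x = (√(2 * Real.pi))⁻¹ * Real.exp (-x ^ 2 / 2) := by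
  simp [gaussianPDFReal]

lemma integrable_gauss_iff {g : ℝ → ℝ} :
    Integrable g gauss ↔ Integrable (fun x => gaussianPDFReal 0 1 x * g x) := by
  rw [gauss, gaussianReal_of_var_ne_zero 0 one_ne_zero,
    integrable_withDensity_iff_integrable_smul' (measurable_gaussianPDF 0 1)
      (Eventually.of_forall fun x => gaussianPDF_lt_top)]
  simp [toReal_gaussianPDF]

lemma hasDerivAt_gaussianPDFReal_zero_one (x : ℝ) :
    HasDerivAt (gaussianPDFReal 0 1) (-x * gaussianPDFReal 0 1 x) x := by
  have h : HasDerivAt (fun y : ℝ => (√(2 * Real.pi))⁻¹ * Real.exp (-y ^ 2 / 2))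
      ((√(2 * Real.pi))⁻¹ * (Real.exp (-x ^ 2 / 2) * (-(2 * x) / 2))) x := by
    simpa using ((((hasDerivAt_id x).pow 2).neg.div_const 2).exp.const_mul
      (√(2 * Real.pi))⁻¹)
  rw [funext gaussianPDFReal_zero_one]
  exact h.congr_deriv (by ring)

/-- Gaussian integration by parts. -/
lemma integral_id_mul_gauss {g g' : ℝ → ℝ} (hg : ∀ x, HasDerivAt g (g' x) x)
    (h0 : Integrable g gauss) (h1 : Integrable g' gauss)
    (h2 : Integrable (fun x => x * g x) gauss) :
    ∫ x, x * g x ∂gauss = ∫ x, g' x ∂gauss := by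
  have key := integral_eq_zero_of_hasDerivAt_of_integrable
    (f := fun x => gaussianPDFReal 0 1 x * g x)
    (f' := fun x => gaussianPDFReal 0 1 x * (g' x - x * g x)) (fun x => by
      exact ((hasDerivAt_gaussianPDFReal_zero_one x).mul (hg x)).congr_deriv (by ring)) (integrable_gauss_iff.1 (h1.sub h2)) (integrable_gauss_iff.1 h0)
  have h3 := integral_gaussianReal_eq_integral_smul (μ := 0) (v := 1)
    (f := fun x => g' x - x * g x) one_ne_zero
  simp only [smul_eq_mul] at h3
  rw [key, integral_sub h1 h2] at h3
  linarith

/-! ### Finite sums of exponentials evolving under the heat flow -/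

section HeatSum

variable {ι : Type*} [Fintype ι]

/-- `∑ c_j exp(i θ_j z - θ_j² r)`. -/
def heatSum (c : ι → ℂ) (θ : ι → ℝ) (z : ℂ) (r : ℝ) : ℂ :=
  ∑ j, c j * Complex.exp (Complex.I * θ j * z - (θ j : ℂ) ^ 2 * r)

/-- A z-derivative brings down iθ_j and an r-derivative −θ_j², so every derivative is again a sum of
the same kind with coefficients c_j θ_j or c_j θ_j². -/
lemma hasDerivAt_heatSum (c : ι → ℂ) (θ : ι → ℝ) {z : ℝ → ℂ} {r : ℝ → ℝ} {z' : ℂ} {r' t : ℝ}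
    (hz : HasDerivAt z z' t) (hr : HasDerivAt r r' t) :
    HasDerivAt (fun x => heatSum c θ (z x) (r x))
      (Complex.I * z' * heatSum (fun j => c j * θ j) θ (z t) (r t)
        - r' * heatSum (fun j => c j * (θ j : ℂ) ^ 2) θ (z t) (r t)) t := by
  have h : ∀ j ∈ Finset.univ, HasDerivAt
      (fun x => c j * Complex.exp (Complex.I * θ j * z x - (θ j : ℂ) ^ 2 * (r x : ℝ)))
      (c j * (Complex.exp (Complex.I * θ j * z t - (θ j : ℂ) ^ 2 * (r t : ℝ)) *
        (Complex.I * θ j * z' - (θ j : ℂ) ^ 2 * (r' : ℝ)))) t := fun j _ =>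
    (((hz.const_mul _).sub (hr.ofReal_comp.const_mul _)).cexp).const_mul _
  refine (HasDerivAt.fun_sum h).congr_deriv ?_
  simp only [heatSum, Finset.mul_sum, ← Finset.sum_sub_distrib]
  exact Finset.sum_congr rfl fun j _ => by ring

lemma norm_heatSum_le (c : ι → ℂ) (θ : ι → ℝ) (z : ℂ) {r : ℝ} (hr : 0 ≤ r) :
    ‖heatSum c θ z r‖ ≤ (∑ j, ‖c j‖) * Real.exp ((∑ j, |θ j|) * |z.im|) := by
  rw [Finset.sum_mul]
  refine (norm_sum_le _ _).trans (Finset.sum_le_sum fun j _ => ?_)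
  rw [norm_mul, Complex.norm_exp]
  gcongr
  have h1 : (Complex.I * θ j * z - (θ j : ℂ) ^ 2 * r).re = -(θ j * z.im) - θ j ^ 2 * r := by
    rw [← Complex.ofReal_pow]
    simp [Complex.mul_re, Complex.mul_im, -Complex.ofReal_pow]
  rw [h1]
  have h2 : |θ j| ≤ ∑ i, |θ i| :=
    Finset.single_le_sum (f := fun i => |θ i|) (fun i _ => abs_nonneg _) (Finset.mem_univ j)
  calc -(θ j * z.im) - θ j ^ 2 * r ≤ |θ j * z.im| := by
        have := neg_abs_le (θ j * z.im)
        nlinarith [mul_nonneg (sq_nonneg (θ j)) hr]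
    _ = |θ j| * |z.im| := abs_mul _ _
    _ ≤ _ := by gcongr

/-- The space variable of the flow, `ξ sin α + i κ η cos α`. -/
def flowZ (κ α ξ η : ℝ) : ℂ := Real.sin α * ξ + Complex.I * κ * Real.cos α * η

/-- The time variable of the flow. -/
def flowR (κ α : ℝ) : ℝ := (1 + κ ^ 2) / 2 * Real.cos α ^ 2

/-- The exponential sum along the flow that rotates the variables `ξ` and `i κ η` into each
other. -/
def flowSum (c : ι → ℂ) (θ : ι → ℝ) (κ α ξ η : ℝ) : ℂ :=
  heatSum c θ (flowZ κ α ξ η) (flowR κ α)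

lemma continuous_flowSum (c : ι → ℂ) (θ : ι → ℝ) (κ : ℝ) :
    Continuous fun x : ℝ × ℝ × ℝ => flowSum c θ κ x.1 x.2.1 x.2.2 := by
  unfold flowSum heatSum flowZ flowR
  fun_prop

lemma hasDerivAt_flowSum_fst (c : ι → ℂ) (θ : ι → ℝ) (κ α ξ η : ℝ) :
    HasDerivAt (fun a => flowSum c θ κ a ξ η)
      ((Real.cos α * ξ : ℝ) * (Complex.I * flowSum (fun j => c j * θ j) θ κ α ξ η)
        + (κ * Real.sin α * η : ℝ) * flowSum (fun j => c j * θ j) θ κ α ξ η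
        + ((1 + κ ^ 2) * Real.sin α * Real.cos α : ℝ)
          * flowSum (fun j => c j * (θ j : ℂ) ^ 2) θ κ α ξ η) α := by
  have hz : HasDerivAt (fun a => flowZ κ a ξ η)
      ((Real.cos α : ℝ) * ξ + Complex.I * κ * (-Real.sin α : ℝ) * η) α :=
    ((Real.hasDerivAt_sin α).ofReal_comp.mul_const _).add
      (((Real.hasDerivAt_cos α).ofReal_comp.const_mul _).mul_const _)
  have hr : HasDerivAt (flowR κ) ((1 + κ ^ 2) / 2 * (2 * Real.cos α * -Real.sin α)) α := by
    refine (((Real.hasDerivAt_cos α).pow 2).const_mul ((1 + κ ^ 2) / 2)).congr_deriv ?_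
    simp
  refine (hasDerivAt_heatSum c θ hz hr).congr_deriv ?_
  simp only [flowSum]
  push_cast
  linear_combination (-(κ * Complex.sin α * η : ℂ) *
    heatSum (fun j => c j * θ j) θ (flowZ κ α ξ η) (flowR κ α)) * Complex.I_sq

lemma hasDerivAt_flowSum_snd (c : ι → ℂ) (θ : ι → ℝ) (κ α ξ η : ℝ) :
    HasDerivAt (fun x => flowSum c θ κ α x η)
      ((Real.sin α : ℝ) * (Complex.I * flowSum (fun j => c j * θ j) θ κ α ξ η)) ξ := by
  have hz : HasDerivAt (fun x => flowZ κ α x η) ((Real.sin α : ℝ) * (1 : ℝ)) ξ :=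
    ((hasDerivAt_id ξ).ofReal_comp.const_mul _).add_const _
  refine (hasDerivAt_heatSum c θ hz (hasDerivAt_const ξ (flowR κ α))).congr_deriv ?_
  simp only [flowSum]
  push_cast
  ring

lemma hasDerivAt_flowSum_trd (c : ι → ℂ) (θ : ι → ℝ) (κ α ξ η : ℝ) :
    HasDerivAt (fun y => flowSum c θ κ α ξ y)
      ((-(κ * Real.cos α) : ℝ) * flowSum (fun j => c j * θ j) θ κ α ξ η) η := by
  have hz : HasDerivAt (fun y => flowZ κ α ξ y)
      (Complex.I * κ * (Real.cos α : ℝ) * (1 : ℝ)) η :=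
    ((hasDerivAt_id η).ofReal_comp.const_mul _).const_add _
  refine (hasDerivAt_heatSum c θ hz (hasDerivAt_const η (flowR κ α))).congr_deriv ?_
  simp only [flowSum]
  push_cast
  linear_combination ((κ * Complex.cos α : ℂ) *
    heatSum (fun j => c j * θ j) θ (flowZ κ α ξ η) (flowR κ α)) * Complex.I_sq

/-- An upper bound for the squares of a flow and of its first two derived flows. -/
def flowMajorant (c : ι → ℂ) (θ : ι → ℝ) (κ ε η : ℝ) : ℝ :=
  ((∑ j, ‖c j‖ * (1 + |θ j| + θ j ^ 2)) ^ 2 + ε) * Real.exp (2 * ((∑ j, |θ j|) * |κ|) * |η|)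

lemma flowMajorant_pos (c : ι → ℂ) (θ : ι → ℝ) (κ η : ℝ) {ε : ℝ} (hε : 0 < ε) :
    0 < flowMajorant c θ κ ε η := by
  unfold flowMajorant
  positivity

lemma continuous_flowMajorant (c : ι → ℂ) (θ : ι → ℝ) (κ ε : ℝ) :
    Continuous (flowMajorant c θ κ ε) := by
  unfold flowMajorant
  fun_prop

/-- Only Im z = κ η cos α makes the exponentials grow, so the bound is uniform in α and ξ and can
dominate every differentiation under the integral. The weight 1 + |θ_j| + θ_j² lets one majorant
serve the flow and both derived flows. -/
lemma normSq_flowSum_add_le (c d : ι → ℂ) (θ : ι → ℝ) (κ α ξ η : ℝ) {ε : ℝ} (hε : 0 ≤ ε)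
    (hd : ∀ j, ‖d j‖ ≤ ‖c j‖ * (1 + |θ j| + θ j ^ 2)) :
    Complex.normSq (flowSum d θ κ α ξ η) + ε ≤ flowMajorant c θ κ ε η := by
  have h1 : ‖flowSum d θ κ α ξ η‖ ≤ (∑ j, ‖c j‖ * (1 + |θ j| + θ j ^ 2)) *
      Real.exp ((∑ j, |θ j|) * |κ| * |η|) := by
    refine (norm_heatSum_le d θ _ (by unfold flowR; positivity)).trans ?_
    have him : (flowZ κ α ξ η).im = κ * Real.cos α * η := by
      simp [flowZ, Complex.mul_im, Complex.mul_re, -Complex.ofReal_cos, -Complex.ofReal_sin]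
    rw [him, abs_mul, abs_mul, mul_assoc (∑ j, |θ j|)]
    have := Real.abs_cos_le_one α
    gcongr with j
    · exact hd j
    · exact mul_le_of_le_one_right (abs_nonneg _) this
  have h2 : (1 : ℝ) ≤ Real.exp (2 * ((∑ j, |θ j|) * |κ|) * |η|) :=
    Real.one_le_exp (by positivity)
  rw [Complex.normSq_eq_norm_sq, flowMajorant, add_mul]
  have h3 := pow_le_pow_left₀ (norm_nonneg _) h1 2
  rw [mul_pow, ← Real.exp_nat_mul] at h3
  push_cast at h3
  rw [← mul_assoc 2 (_ * _)  |η|] at h3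
  nlinarith

lemma integrable_flowMajorant (c : ι → ℂ) (θ : ι → ℝ) (κ : ℝ) {ε : ℝ} (hε : 0 ≤ ε) (s : ℝ) :
    Integrable (fun η => (1 + |η|) * flowMajorant c θ κ ε η ^ s) gauss := by
  have h := (integrable_one_add_abs_mul_exp_gauss (2 * ((∑ j, |θ j|) * |κ|) * s)).const_mul
    (((∑ j, ‖c j‖ * (1 + |θ j| + θ j ^ 2)) ^ 2 + ε) ^ s)
  refine h.congr (Eventually.of_forall fun η => ?_)
  simp only [flowMajorant]
  rw [Real.mul_rpow (by positivity) (Real.exp_pos _).le, ← Real.exp_mul,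
    mul_right_comm _ |η| s]
  ring

end HeatSum

/-! ### The function `(|w|² + ε)^s` and its derivatives -/

/-- The derivative of `(|w|² + ε)^s` in the direction `u`. -/
def powDeriv (ε s : ℝ) (w u : ℂ) : ℝ :=
  2 * s * (Complex.normSq w + ε) ^ (s - 1) * (u * conj w).re

/-- The second derivative of `(|w|² + ε)^s` in the direction `u`. -/
def powDeriv₂ (ε s : ℝ) (w u : ℂ) : ℝ :=
  2 * s * (Complex.normSq w + ε) ^ (s - 1) * Complex.normSq u
    + 4 * s * (s - 1) * (Complex.normSq w + ε) ^ (s - 2) * (u * conj w).re ^ 2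

lemma normSq_add_pos (w : ℂ) {ε : ℝ} (hε : 0 < ε) : 0 < Complex.normSq w + ε :=
  add_pos_of_nonneg_of_pos (Complex.normSq_nonneg w) hε

lemma powDeriv_add (ε s : ℝ) (w u u' : ℂ) :
    powDeriv ε s w (u + u') = powDeriv ε s w u + powDeriv ε s w u' := by
  simp only [powDeriv, add_mul, Complex.add_re, mul_add]

lemma powDeriv_ofReal_mul (ε s : ℝ) (w u : ℂ) (a : ℝ) :
    powDeriv ε s w (a * u) = a * powDeriv ε s w u := by
  simp only [powDeriv, mul_assoc, Complex.re_ofReal_mul]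
  ring

lemma hasDerivAt_normSq {w : ℝ → ℂ} {w' : ℂ} {t : ℝ} (hw : HasDerivAt w w' t) :
    HasDerivAt (fun x => Complex.normSq (w x)) (2 * (w' * conj (w t)).re) t := by
  have hre : HasDerivAt (fun x => (w x).re) w'.re t := by
    exact Complex.reCLM.hasFDerivAt.comp_hasDerivAt t hw
  have him : HasDerivAt (fun x => (w x).im) w'.im t := by
    exact Complex.imCLM.hasFDerivAt.comp_hasDerivAt t hw
  simp only [Complex.normSq_apply]
  refine ((hre.mul hre).add (him.mul him)).congr_deriv ?_
  simp
  ring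

lemma hasDerivAt_re_mul_conj {w u : ℝ → ℂ} {w' u' : ℂ} {t : ℝ} (hw : HasDerivAt w w' t)
    (hu : HasDerivAt u u' t) :
    HasDerivAt (fun x => (u x * conj (w x)).re)
      ((u' * conj (w t)).re + (u t * conj w').re) t := by
  have hc : HasDerivAt (fun x => conj (w x)) (conj w') t := by
    exact Complex.conjCLE.toContinuousLinearMap.hasFDerivAt.comp_hasDerivAt t hw
  exact Complex.reCLM.hasFDerivAt.comp_hasDerivAt t (hu.mul hc)

lemma hasDerivAt_normSq_add_rpow {w : ℝ → ℂ} {w' : ℂ} {t ε : ℝ} (s : ℝ) (hε : 0 < ε)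
    (hw : HasDerivAt w w' t) :
    HasDerivAt (fun x => (Complex.normSq (w x) + ε) ^ s) (powDeriv ε s (w t) w') t := by
  refine (((hasDerivAt_normSq hw).add_const ε).rpow_const (p := s)
    (Or.inl (normSq_add_pos (w t) hε).ne')).congr_deriv ?_
  rw [powDeriv]
  ring

lemma hasDerivAt_powDeriv {w u : ℝ → ℂ} {u' : ℂ} {t ε a : ℝ} (s : ℝ) (hε : 0 < ε)
    (hw : HasDerivAt w (a * u t) t) (hu : HasDerivAt u u' t) :
    HasDerivAt (fun x => powDeriv ε s (w x) (u x))
      (a * powDeriv₂ ε s (w t) (u t) + powDeriv ε s (w t) u') t := by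
  have h := ((hasDerivAt_normSq_add_rpow (s - 1) hε hw).const_mul (2 * s)).mul
    (hasDerivAt_re_mul_conj hw hu)
  refine h.congr_deriv ?_
  have h1 : (u t * conj (a * u t)).re = a * Complex.normSq (u t) := by
    simp [Complex.normSq_apply]; ring
  have h2 : s - 1 - 1 = s - 2 := by ring
  rw [powDeriv_ofReal_mul, h1]
  simp only [powDeriv, powDeriv₂, h2]
  ring

lemma sq_re_mul_conj_le (w u : ℂ) {ε : ℝ} (hε : 0 ≤ ε) :
    (u * conj w).re ^ 2 ≤ Complex.normSq u * (Complex.normSq w + ε) := by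
  have h : Complex.normSq (u * conj w) = Complex.normSq u * Complex.normSq w := by simp
  have h1 := Complex.re_sq_le_normSq (u * conj w)
  nlinarith [mul_nonneg (Complex.normSq_nonneg u) hε, sq (u * conj w).re]

lemma abs_powDeriv_le {ε s R : ℝ} {w u : ℂ} (hs : 1 ≤ s) (hε : 0 < ε)
    (hw : Complex.normSq w + ε ≤ R) (hu : Complex.normSq u ≤ R) :
    |powDeriv ε s w u| ≤ 2 * s * R ^ s := by
  have hρ := normSq_add_pos w hε
  have hR : 0 < R := hρ.trans_le hw
  have h1 : |(u * conj w).re| ≤ R := by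
    refine abs_le_of_sq_le_sq ((sq_re_mul_conj_le w u hε.le).trans ?_) hR.le
    rw [sq]
    exact mul_le_mul hu hw hρ.le hR.le
  rw [powDeriv, abs_mul, abs_of_nonneg (by positivity), mul_assoc]
  have h2 : (Complex.normSq w + ε) ^ (s - 1) ≤ R ^ (s - 1) :=
    Real.rpow_le_rpow hρ.le hw (by linarith)
  have h3 : R ^ s = R ^ (s - 1) * R := by
    rw [Real.rpow_sub_one hR.ne']; field_simp
  rw [h3]
  gcongr

lemma abs_powDeriv₂_le {ε s R : ℝ} {w u : ℂ} (hs : 1 ≤ s) (hε : 0 < ε)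
    (hw : Complex.normSq w + ε ≤ R) (hu : Complex.normSq u ≤ R) :
    |powDeriv₂ ε s w u| ≤ 4 * s ^ 2 * R ^ s := by
  have hρ := normSq_add_pos w hε
  have hR : 0 < R := hρ.trans_le hw
  have hu0 := Complex.normSq_nonneg u
  have hs1 : 0 ≤ s - 1 := by linarith
  rw [powDeriv₂, abs_of_nonneg (by positivity)]
  have h2 : (Complex.normSq w + ε) ^ (s - 1) * Complex.normSq u ≤ R ^ (s - 1) * R := by
    have : (Complex.normSq w + ε) ^ (s - 1) ≤ R ^ (s - 1) :=
      Real.rpow_le_rpow hρ.le hw hs1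
    gcongr
  have h3 : R ^ s = R ^ (s - 1) * R := by
    rw [Real.rpow_sub_one hR.ne']; field_simp
  -- The exponent s − 2 may be negative, so this power cannot be compared with R^(s − 2) directly;
  -- Cauchy–Schwarz on the squared factor supplies the missing power of |w|² + ε.
  have h4 : (Complex.normSq w + ε) ^ (s - 2) * (u * conj w).re ^ 2
      ≤ (Complex.normSq w + ε) ^ (s - 1) * Complex.normSq u := by
    have e : (Complex.normSq w + ε) ^ (s - 1)
        = (Complex.normSq w + ε) ^ (s - 2) * (Complex.normSq w + ε) := by
      rw [← Real.rpow_add_one hρ.ne']; congr 1; ring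
    rw [e, mul_assoc, mul_comm (Complex.normSq w + ε)]
    gcongr
    exact sq_re_mul_conj_le w u hε.le
  rw [← h3] at h2
  have h5 := h4.trans h2
  have h6 : 0 ≤ 4 * s * (s - 1) := by positivity
  have h7 : (0 : ℝ) ≤ 2 * s := by positivity
  have h8 : 0 ≤ R ^ s := by positivity
  nlinarith [mul_le_mul_of_nonneg_left h5 h6, mul_le_mul_of_nonneg_left h2 h7,
    mul_nonneg (by linarith : (0 : ℝ) ≤ s) h8]

/-- The pointwise inequality behind the monotonicity of the flow; the exponents are `p`, with
`p - 1 = κ²`, and its conjugate `2 s`. -/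
lemma powDeriv₂_I_mul_sub_ge {ε s p : ℝ} (w u : ℂ) (hε : 0 < ε) (hs : 1 ≤ s) (hp2 : p ≤ 2)
    (hsp : (2 * s - 1) * (p - 1) = 1) :
    2 * s * (2 * s - p) * ((Complex.normSq w + ε) ^ (s - 2) * (Complex.I * u * conj w).re ^ 2)
      ≤ powDeriv₂ ε s w (Complex.I * u) - (p - 1) * powDeriv₂ ε s w u := by
  have hρ := normSq_add_pos w hε
  have e : (Complex.normSq w + ε) ^ (s - 1)
      = (Complex.normSq w + ε) ^ (s - 2) * (Complex.normSq w + ε) := by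
    rw [← Real.rpow_add_one hρ.ne']; congr 1; ring
  have h1 : Complex.normSq (Complex.I * u) = Complex.normSq u := by simp
  have h2 : (Complex.I * u * conj w).re ^ 2 + (u * conj w).re ^ 2
      = Complex.normSq u * Complex.normSq w := by
    have : Complex.normSq (u * conj w) = Complex.normSq u * Complex.normSq w := by simp
    rw [← this, Complex.normSq_apply, mul_assoc, Complex.I_mul_re]
    ring
  simp only [powDeriv₂, h1, e]
  set X := (Complex.normSq w + ε) ^ (s - 2)
  have hX : 0 < X := Real.rpow_pos_of_pos hρ _
  set a := (Complex.I * u * conj w).re ^ 2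
  set b := (u * conj w).re ^ 2
  -- This is exactly the difference of the two sides. With |u|²|w|² = a + b, the coefficient of a is
  -- 2s(2s − p), and that of b vanishes because (2s − 1)(p − 1) = 1; only the ε-term remains.
  have h3 : 0 ≤ 2 * s * (2 - p) * X * (Complex.normSq u * ε) := by
    have := Complex.normSq_nonneg u
    have : 0 ≤ 2 - p := by linarith
    positivity
  refine le_of_sub_nonneg (h3.trans (le_of_eq ?_))
  linear_combination (2 * s * (2 - p) * X) * h2 + 2 * s * X * b * hsp

/-! ### Inner Gaussian means along the flow and their derivatives -/

section Flow

variable {ι : Type*} [Fintype ι] (c : ι → ℂ) (θ : ι → ℝ) (κ ε s : ℝ)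

/-- The first derived flow. -/
def flowSum₁ (α ξ η : ℝ) : ℂ := flowSum (fun j => c j * θ j) θ κ α ξ η

/-- The second derived flow. -/
def flowSum₂ (α ξ η : ℝ) : ℂ := flowSum (fun j => c j * (θ j : ℂ) ^ 2) θ κ α ξ η

/-- `E_η (|w|² + ε)^s` along the flow. -/
def flowH (α ξ : ℝ) : ℝ := ∫ η, (Complex.normSq (flowSum c θ κ α ξ η) + ε) ^ s ∂gauss

/-- The mean of the derivative in the direction `i w₁`. -/
def flowM (α ξ : ℝ) : ℝ :=
  ∫ η, powDeriv ε s (flowSum c θ κ α ξ η) (Complex.I * flowSum₁ c θ κ α ξ η) ∂gauss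

/-- The mean of the derivative in the direction `w₂`. -/
def flowK (α ξ : ℝ) : ℝ :=
  ∫ η, powDeriv ε s (flowSum c θ κ α ξ η) (flowSum₂ c θ κ α ξ η) ∂gauss

/-- The mean of the second derivative in the direction `i w₁`. -/
def flowDI (α ξ : ℝ) : ℝ :=
  ∫ η, powDeriv₂ ε s (flowSum c θ κ α ξ η) (Complex.I * flowSum₁ c θ κ α ξ η) ∂gauss

/-- The mean of the second derivative in the direction `w₁`. -/
def flowD (α ξ : ℝ) : ℝ :=
  ∫ η, powDeriv₂ ε s (flowSum c θ κ α ξ η) (flowSum₁ c θ κ α ξ η) ∂gauss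

variable {ε s}

lemma continuous_powDeriv {X : Type*} [TopologicalSpace X] {w u : X → ℂ} (s : ℝ) (hε : 0 < ε)
    (hw : Continuous w) (hu : Continuous u) : Continuous fun x => powDeriv ε s (w x) (u x) := by
  have h : Continuous fun x => (Complex.normSq (w x) + ε) ^ (s - 1) :=
    ((Complex.continuous_normSq.comp hw).add_const ε).rpow_const
      fun x => Or.inl (normSq_add_pos (w x) hε).ne'
  unfold powDeriv
  fun_prop

lemma continuous_powDeriv₂ {X : Type*} [TopologicalSpace X] {w u : X → ℂ} (s : ℝ) (hε : 0 < ε)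
    (hw : Continuous w) (hu : Continuous u) : Continuous fun x => powDeriv₂ ε s (w x) (u x) := by
  have h (r : ℝ) : Continuous fun x => (Complex.normSq (w x) + ε) ^ r :=
    ((Complex.continuous_normSq.comp hw).add_const ε).rpow_const
      fun x => Or.inl (normSq_add_pos (w x) hε).ne'
  have h1 := h (s - 1)
  have h2 := h (s - 2)
  have h3 : Continuous fun x => Complex.normSq (u x) := Complex.continuous_normSq.comp hu
  unfold powDeriv₂
  fun_prop

lemma continuous_flowSum_comp {X : Type*} [TopologicalSpace X] (d : ι → ℂ) {a x y : X → ℝ}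
    (ha : Continuous a) (hx : Continuous x) (hy : Continuous y) :
    Continuous fun t => flowSum d θ κ (a t) (x t) (y t) :=
  Continuous.comp (g := fun v : ℝ × ℝ × ℝ => flowSum d θ κ v.1 v.2.1 v.2.2)
    (f := fun t => (a t, x t, y t)) (continuous_flowSum d θ κ) (ha.prodMk (hx.prodMk hy))

lemma normSq_flowSum_add_le_majorant (hε : 0 ≤ ε) (α ξ η : ℝ) :
    Complex.normSq (flowSum c θ κ α ξ η) + ε ≤ flowMajorant c θ κ ε η := by
  refine normSq_flowSum_add_le c c θ κ α ξ η hε fun j => ?_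
  exact le_mul_of_one_le_right (norm_nonneg _) (by linarith [abs_nonneg (θ j), sq_nonneg (θ j)])

lemma normSq_flowSum₁_le_majorant (hε : 0 ≤ ε) (α ξ η : ℝ) :
    Complex.normSq (flowSum₁ c θ κ α ξ η) ≤ flowMajorant c θ κ ε η := by
  refine (le_add_of_nonneg_right hε).trans
    (normSq_flowSum_add_le c _ θ κ α ξ η hε fun j => ?_)
  rw [norm_mul, Complex.norm_real, Real.norm_eq_abs]
  gcongr
  linarith [abs_nonneg (θ j), sq_nonneg (θ j)]

lemma normSq_flowSum₂_le_majorant (hε : 0 ≤ ε) (α ξ η : ℝ) :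
    Complex.normSq (flowSum₂ c θ κ α ξ η) ≤ flowMajorant c θ κ ε η := by
  refine (le_add_of_nonneg_right hε).trans
    (normSq_flowSum_add_le c _ θ κ α ξ η hε fun j => ?_)
  rw [norm_mul, norm_pow, Complex.norm_real, Real.norm_eq_abs, sq_abs]
  gcongr
  linarith [abs_nonneg (θ j), sq_nonneg (θ j)]

lemma normSq_I_mul_flowSum₁_le_majorant (hε : 0 ≤ ε) (α ξ η : ℝ) :
    Complex.normSq (Complex.I * flowSum₁ c θ κ α ξ η) ≤ flowMajorant c θ κ ε η := by
  simpa using normSq_flowSum₁_le_majorant c θ κ hε α ξ η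

lemma normSq_flowSum_add_rpow_le (hε : 0 < ε) (hs : 0 ≤ s) (α ξ η : ℝ) :
    (Complex.normSq (flowSum c θ κ α ξ η) + ε) ^ s ≤ flowMajorant c θ κ ε η ^ s :=
  Real.rpow_le_rpow (normSq_add_pos _ hε).le (normSq_flowSum_add_le_majorant c θ κ hε.le α ξ η) hs

lemma integrable_majorant_rpow (hε : 0 < ε) (s : ℝ) :
    Integrable (fun η => flowMajorant c θ κ ε η ^ s) gauss := by
  refine (integrable_flowMajorant c θ κ hε.le s).mono'
    (by exact ((continuous_flowMajorant c θ κ ε).rpow_const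
      fun η => Or.inl (flowMajorant_pos c θ κ η hε).ne').aestronglyMeasurable)
    (Eventually.of_forall fun η => ?_)
  have := Real.rpow_nonneg (flowMajorant_pos c θ κ η hε).le s
  rw [Real.norm_of_nonneg this]
  exact le_mul_of_one_le_left this (by linarith [abs_nonneg η])

lemma integrable_one_add_abs_mul_of_le_majorant (hε : 0 < ε) {g : ℝ → ℝ} {C : ℝ}
    (hg : Continuous g) (h : ∀ η, |g η| ≤ C * flowMajorant c θ κ ε η ^ s) :
    Integrable (fun η => (1 + |η|) * |g η|) gauss := by
  refine ((integrable_flowMajorant c θ κ hε.le s).const_mul C).mono' (by fun_prop)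
    (Eventually.of_forall fun η => ?_)
  rw [Real.norm_of_nonneg (by positivity), mul_left_comm]
  exact mul_le_mul_of_nonneg_left (h η) (by positivity)

lemma integrable_of_le_majorant (hε : 0 < ε) {g : ℝ → ℝ} {C : ℝ} (hg : Continuous g)
    (h : ∀ η, |g η| ≤ C * flowMajorant c θ κ ε η ^ s) : Integrable g gauss :=
  ((integrable_majorant_rpow c θ κ hε s).const_mul C).mono' hg.aestronglyMeasurable
    (Eventually.of_forall fun η => h η)

lemma integrable_id_mul_of_le_majorant (hε : 0 < ε) {g : ℝ → ℝ} {C : ℝ} (hg : Continuous g)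
    (h : ∀ η, |g η| ≤ C * flowMajorant c θ κ ε η ^ s) :
    Integrable (fun η => η * g η) gauss :=
  (integrable_one_add_abs_mul_of_le_majorant c θ κ hε hg h).mono' (by fun_prop)
    (Eventually.of_forall fun η => by
      rw [norm_mul, Real.norm_eq_abs, Real.norm_eq_abs]
      gcongr
      linarith)

lemma abs_integral_le_of_le_majorant (hε : 0 < ε) {g : ℝ → ℝ} {C : ℝ}
    (h : ∀ η, |g η| ≤ C * flowMajorant c θ κ ε η ^ s) :
    |∫ η, g η ∂gauss| ≤ C * ∫ η, flowMajorant c θ κ ε η ^ s ∂gauss := by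
  rw [← integral_const_mul]
  exact norm_integral_le_of_norm_le (f := g) ((integrable_majorant_rpow c θ κ hε s).const_mul C)
    (Eventually.of_forall fun η => h η)

lemma continuous_normSq_flowSum_add_rpow {X : Type*} [TopologicalSpace X] (hε : 0 < ε) (s : ℝ)
    {a x y : X → ℝ} (ha : Continuous a) (hx : Continuous x) (hy : Continuous y) :
    Continuous fun t => (Complex.normSq (flowSum c θ κ (a t) (x t) (y t)) + ε) ^ s :=
  ((Complex.continuous_normSq.comp (continuous_flowSum_comp θ κ c ha hx hy)).add_const ε).rpow_const
      fun _ => Or.inl (normSq_add_pos _ hε).ne'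

lemma hasDerivAt_flowSum₁_snd (α ξ η : ℝ) :
    HasDerivAt (fun x => flowSum₁ c θ κ α x η)
      ((Real.sin α : ℝ) * (Complex.I * flowSum₂ c θ κ α ξ η)) ξ := by
  have h := hasDerivAt_flowSum_snd (fun j => c j * θ j) θ κ α ξ η
  unfold flowSum₁ flowSum₂
  simpa only [mul_assoc (c _), ← sq] using h

lemma hasDerivAt_flowSum₁_trd (α ξ η : ℝ) :
    HasDerivAt (fun y => flowSum₁ c θ κ α ξ y)
      ((-(κ * Real.cos α) : ℝ) * flowSum₂ c θ κ α ξ η) η := by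
  have h := hasDerivAt_flowSum_trd (fun j => c j * θ j) θ κ α ξ η
  unfold flowSum₁ flowSum₂
  simpa only [mul_assoc (c _), ← sq] using h

lemma abs_powDeriv_flow_I_le (hε : 0 < ε) (hs : 1 ≤ s) (α ξ η : ℝ) :
    |powDeriv ε s (flowSum c θ κ α ξ η) (Complex.I * flowSum₁ c θ κ α ξ η)|
      ≤ 2 * s * flowMajorant c θ κ ε η ^ s :=
  abs_powDeriv_le hs hε (normSq_flowSum_add_le_majorant c θ κ hε.le α ξ η)
    (normSq_I_mul_flowSum₁_le_majorant c θ κ hε.le α ξ η)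

lemma abs_powDeriv_flow₁_le (hε : 0 < ε) (hs : 1 ≤ s) (α ξ η : ℝ) :
    |powDeriv ε s (flowSum c θ κ α ξ η) (flowSum₁ c θ κ α ξ η)|
      ≤ 2 * s * flowMajorant c θ κ ε η ^ s :=
  abs_powDeriv_le hs hε (normSq_flowSum_add_le_majorant c θ κ hε.le α ξ η)
    (normSq_flowSum₁_le_majorant c θ κ hε.le α ξ η)

lemma abs_powDeriv_flow₂_le (hε : 0 < ε) (hs : 1 ≤ s) (α ξ η : ℝ) :
    |powDeriv ε s (flowSum c θ κ α ξ η) (flowSum₂ c θ κ α ξ η)|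
      ≤ 2 * s * flowMajorant c θ κ ε η ^ s :=
  abs_powDeriv_le hs hε (normSq_flowSum_add_le_majorant c θ κ hε.le α ξ η)
    (normSq_flowSum₂_le_majorant c θ κ hε.le α ξ η)

lemma abs_powDeriv₂_flow_I_le (hε : 0 < ε) (hs : 1 ≤ s) (α ξ η : ℝ) :
    |powDeriv₂ ε s (flowSum c θ κ α ξ η) (Complex.I * flowSum₁ c θ κ α ξ η)|
      ≤ 4 * s ^ 2 * flowMajorant c θ κ ε η ^ s :=
  abs_powDeriv₂_le hs hε (normSq_flowSum_add_le_majorant c θ κ hε.le α ξ η)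
    (normSq_I_mul_flowSum₁_le_majorant c θ κ hε.le α ξ η)

lemma abs_powDeriv₂_flow_le (hε : 0 < ε) (hs : 1 ≤ s) (α ξ η : ℝ) :
    |powDeriv₂ ε s (flowSum c θ κ α ξ η) (flowSum₁ c θ κ α ξ η)|
      ≤ 4 * s ^ 2 * flowMajorant c θ κ ε η ^ s :=
  abs_powDeriv₂_le hs hε (normSq_flowSum_add_le_majorant c θ κ hε.le α ξ η)
    (normSq_flowSum₁_le_majorant c θ κ hε.le α ξ η)

lemma continuous_flowSum₁_comp {X : Type*} [TopologicalSpace X] {a x y : X → ℝ}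
    (ha : Continuous a) (hx : Continuous x) (hy : Continuous y) :
    Continuous fun t => flowSum₁ c θ κ (a t) (x t) (y t) :=
  continuous_flowSum_comp θ κ _ ha hx hy

lemma continuous_flowSum₂_comp {X : Type*} [TopologicalSpace X] {a x y : X → ℝ}
    (ha : Continuous a) (hx : Continuous x) (hy : Continuous y) :
    Continuous fun t => flowSum₂ c θ κ (a t) (x t) (y t) :=
  continuous_flowSum_comp θ κ _ ha hx hy

/-- Integration by parts in the inner variable. -/
lemma integral_id_mul_powDeriv_flow (hε : 0 < ε) (hs : 1 ≤ s) (α ξ : ℝ) :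
    ∫ η, η * powDeriv ε s (flowSum c θ κ α ξ η) (flowSum₁ c θ κ α ξ η) ∂gauss
      = -(κ * Real.cos α) * (flowD c θ κ ε s α ξ + flowK c θ κ ε s α ξ) := by
  have c0 := continuous_flowSum_comp θ κ c (continuous_const (y := α)) (continuous_const (y := ξ))
    continuous_id'
  have c1 := continuous_flowSum₁_comp c θ κ (continuous_const (y := α)) (continuous_const (y := ξ))
    continuous_id'
  have c2 := continuous_flowSum₂_comp c θ κ (continuous_const (y := α)) (continuous_const (y := ξ))
    continuous_id'
  have i1 := integrable_of_le_majorant c θ κ hε (continuous_powDeriv₂ s hε c0 c1)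
    (abs_powDeriv₂_flow_le c θ κ hε hs α ξ)
  have i2 := integrable_of_le_majorant c θ κ hε (continuous_powDeriv s hε c0 c2)
    (abs_powDeriv_flow₂_le c θ κ hε hs α ξ)
  rw [integral_id_mul_gauss (g' := fun η => -(κ * Real.cos α) *
      (powDeriv₂ ε s (flowSum c θ κ α ξ η) (flowSum₁ c θ κ α ξ η)
        + powDeriv ε s (flowSum c θ κ α ξ η) (flowSum₂ c θ κ α ξ η))) (fun η => ?_)
    (integrable_of_le_majorant c θ κ hε (continuous_powDeriv s hε c0 c1)
      (abs_powDeriv_flow₁_le c θ κ hε hs α ξ)) ((i1.add i2).const_mul _)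
    (integrable_id_mul_of_le_majorant c θ κ hε (continuous_powDeriv s hε c0 c1)
      (abs_powDeriv_flow₁_le c θ κ hε hs α ξ)), integral_const_mul, integral_add i1 i2]
  · rfl
  · refine (hasDerivAt_powDeriv s hε (hasDerivAt_flowSum_trd c θ κ α ξ η)
      (hasDerivAt_flowSum₁_trd c θ κ α ξ η)).congr_deriv ?_
    rw [powDeriv_ofReal_mul]
    simp only [flowSum₁, mul_add]

/-- The term carrying a factor η is integrated by parts and contributes −κ² sin α cos α (D + K). The
heat time contributes (1 + κ²) sin α cos α K, so the κ²K terms cancel. -/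
lemma hasDerivAt_flowH_fst (hε : 0 < ε) (hs : 1 ≤ s) (α ξ : ℝ) :
    HasDerivAt (fun a => flowH c θ κ ε s a ξ)
      (Real.cos α * ξ * flowM c θ κ ε s α ξ
        + Real.sin α * Real.cos α * (flowK c θ κ ε s α ξ - κ ^ 2 * flowD c θ κ ε s α ξ)) α := by
  have cont (a : ℝ) := continuous_normSq_flowSum_add_rpow c θ κ hε s (continuous_const (y := a))
    (continuous_const (y := ξ)) continuous_id'
  have c0 := continuous_flowSum_comp θ κ c (continuous_const (y := α)) (continuous_const (y := ξ))
    continuous_id'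
  have c1 := continuous_flowSum₁_comp c θ κ (continuous_const (y := α)) (continuous_const (y := ξ))
    continuous_id'
  have c2 := continuous_flowSum₂_comp c θ κ (continuous_const (y := α)) (continuous_const (y := ξ))
    continuous_id'
  have cI : Continuous fun η => powDeriv ε s (flowSum c θ κ α ξ η)
      (Complex.I * flowSum₁ c θ κ α ξ η) := continuous_powDeriv s hε c0 (continuous_const.mul c1)
  have c1' : Continuous fun η => powDeriv ε s (flowSum c θ κ α ξ η)
      (flowSum₁ c θ κ α ξ η) := continuous_powDeriv s hε c0 c1
  have c2' : Continuous fun η => powDeriv ε s (flowSum c θ κ α ξ η)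
      (flowSum₂ c θ κ α ξ η) := continuous_powDeriv s hε c0 c2
  have h := (hasDerivAt_integral_of_dominated_loc_of_deriv_le (μ := gauss) (x₀ := α)
    (F := fun a η => (Complex.normSq (flowSum c θ κ a ξ η) + ε) ^ s)
    (F' := fun a η => Real.cos a * ξ *
        powDeriv ε s (flowSum c θ κ a ξ η) (Complex.I * flowSum₁ c θ κ a ξ η)
      + κ * Real.sin a * (η * powDeriv ε s (flowSum c θ κ a ξ η) (flowSum₁ c θ κ a ξ η))
      + (1 + κ ^ 2) * Real.sin a * Real.cos a *
        powDeriv ε s (flowSum c θ κ a ξ η) (flowSum₂ c θ κ a ξ η))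
    (bound := fun η => (|ξ| + |κ| + (1 + κ ^ 2)) * (2 * s) *
      ((1 + |η|) * flowMajorant c θ κ ε η ^ s))
    univ_mem (Eventually.of_forall fun a => (cont a).aestronglyMeasurable)
    (integrable_of_le_majorant c θ κ (s := s) (C := 1) hε (cont α) fun η => ?_)
    (by exact (Continuous.aestronglyMeasurable (by fun_prop)))
    (Eventually.of_forall fun η a _ => ?_)
    ((integrable_flowMajorant c θ κ hε.le s).const_mul _)
    (Eventually.of_forall fun η a _ => ?_)).2
  · refine h.congr_deriv ?_
    rw [integral_add, integral_add, integral_const_mul, integral_const_mul, integral_const_mul,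
      integral_id_mul_powDeriv_flow c θ κ hε hs]
    · simp only [flowM, flowK]
      ring
    · exact (integrable_of_le_majorant c θ κ hε cI (abs_powDeriv_flow_I_le c θ κ hε hs α ξ)).const_mul _
    · exact (integrable_id_mul_of_le_majorant c θ κ hε c1'
        (abs_powDeriv_flow₁_le c θ κ hε hs α ξ)).const_mul _
    · exact ((integrable_of_le_majorant c θ κ hε cI
        (abs_powDeriv_flow_I_le c θ κ hε hs α ξ)).const_mul _).add
        ((integrable_id_mul_of_le_majorant c θ κ hε c1'
        (abs_powDeriv_flow₁_le c θ κ hε hs α ξ)).const_mul _)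
    · exact (integrable_of_le_majorant c θ κ hε c2' (abs_powDeriv_flow₂_le c θ κ hε hs α ξ)).const_mul _
  · rw [abs_of_nonneg (Real.rpow_nonneg (normSq_add_pos _ hε).le _), one_mul]
    exact normSq_flowSum_add_rpow_le c θ κ hε (by linarith) α ξ η
  · set R := flowMajorant c θ κ ε η ^ s
    have hR : 0 ≤ R := Real.rpow_nonneg (flowMajorant_pos c θ κ η hε).le s
    have hc := Real.abs_cos_le_one a
    have hsn := Real.abs_sin_le_one a
    have b1 : |Real.cos a * ξ *
        powDeriv ε s (flowSum c θ κ a ξ η) (Complex.I * flowSum₁ c θ κ a ξ η)|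
        ≤ 1 * |ξ| * (2 * s * R) := by
      rw [abs_mul, abs_mul]
      gcongr
      exact abs_powDeriv_flow_I_le c θ κ hε hs a ξ η
    have b2 : |κ * Real.sin a * (η * powDeriv ε s (flowSum c θ κ a ξ η) (flowSum₁ c θ κ a ξ η))|
        ≤ |κ| * 1 * (|η| * (2 * s * R)) := by
      rw [abs_mul, abs_mul, abs_mul]
      gcongr
      exact abs_powDeriv_flow₁_le c θ κ hε hs a ξ η
    have b3 : |(1 + κ ^ 2) * Real.sin a * Real.cos a *
        powDeriv ε s (flowSum c θ κ a ξ η) (flowSum₂ c θ κ a ξ η)|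
        ≤ (1 + κ ^ 2) * 1 * 1 * (2 * s * R) := by
      rw [abs_mul, abs_mul, abs_mul, abs_of_nonneg (by positivity : 0 ≤ 1 + κ ^ 2)]
      gcongr
      exact abs_powDeriv_flow₂_le c θ κ hε hs a ξ η
    refine (abs_add_three _ _ _).trans ((add_le_add_three b1 b2 b3).trans ?_)
    have hsR : 0 ≤ 2 * s * R := by positivity
    have e1 : 0 ≤ (|ξ| + (1 + κ ^ 2)) * |η| * (2 * s * R) := by positivity
    have e2 : 0 ≤ |κ| * (2 * s * R) := by positivity
    nlinarith
  · refine (hasDerivAt_normSq_add_rpow s hε (hasDerivAt_flowSum_fst c θ κ a ξ η)).congr_deriv ?_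
    rw [powDeriv_add, powDeriv_add, powDeriv_ofReal_mul, powDeriv_ofReal_mul, powDeriv_ofReal_mul]
    simp only [flowSum₁, flowSum₂]
    ring

lemma hasDerivAt_flowH_snd (hε : 0 < ε) (hs : 1 ≤ s) (α ξ : ℝ) :
    HasDerivAt (fun x => flowH c θ κ ε s α x) (Real.sin α * flowM c θ κ ε s α ξ) ξ := by
  have cont (x : ℝ) := continuous_normSq_flowSum_add_rpow c θ κ hε s (continuous_const (y := α))
    (continuous_const (y := x)) continuous_id'
  have c0 := continuous_flowSum_comp θ κ c (continuous_const (y := α)) (continuous_const (y := ξ))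
    continuous_id'
  have c1 := continuous_flowSum₁_comp c θ κ (continuous_const (y := α)) (continuous_const (y := ξ))
    continuous_id'
  have h := (hasDerivAt_integral_of_dominated_loc_of_deriv_le (μ := gauss) (x₀ := ξ)
    (F := fun x η => (Complex.normSq (flowSum c θ κ α x η) + ε) ^ s)
    (F' := fun x η => Real.sin α *
        powDeriv ε s (flowSum c θ κ α x η) (Complex.I * flowSum₁ c θ κ α x η))
    (bound := fun η => 2 * s * flowMajorant c θ κ ε η ^ s)
    univ_mem (Eventually.of_forall fun x => (cont x).aestronglyMeasurable)
    (integrable_of_le_majorant c θ κ (s := s) (C := 1) hε (cont ξ) fun η => ?_)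
    (by exact (continuous_const.mul
      (continuous_powDeriv s hε c0 (continuous_const.mul c1))).aestronglyMeasurable)
    (Eventually.of_forall fun η x _ => ?_)
    ((integrable_majorant_rpow c θ κ hε s).const_mul _)
    (Eventually.of_forall fun η x _ => ?_)).2
  · exact h.congr_deriv (integral_const_mul _ _)
  · rw [abs_of_nonneg (Real.rpow_nonneg (normSq_add_pos _ hε).le _), one_mul]
    exact normSq_flowSum_add_rpow_le c θ κ hε (by linarith) α ξ η
  · rw [Real.norm_eq_abs, abs_mul]
    refine (mul_le_of_le_one_left (abs_nonneg _) (Real.abs_sin_le_one α)).trans ?_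
    exact abs_powDeriv_flow_I_le c θ κ hε hs α x η
  · refine (hasDerivAt_normSq_add_rpow s hε (hasDerivAt_flowSum_snd c θ κ α x η)).congr_deriv ?_
    rw [powDeriv_ofReal_mul]
    rfl

/-- Differentiating the direction i w₁ in ξ brings a second factor i, hence the direction −w₂ and
the term −K, which later cancels the +K of `hasDerivAt_flowH_fst`. -/
lemma hasDerivAt_flowM_snd (hε : 0 < ε) (hs : 1 ≤ s) (α ξ : ℝ) :
    HasDerivAt (fun x => flowM c θ κ ε s α x)
      (Real.sin α * (flowDI c θ κ ε s α ξ - flowK c θ κ ε s α ξ)) ξ := by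
  have c0 (x : ℝ) := continuous_flowSum_comp θ κ c (continuous_const (y := α))
    (continuous_const (y := x)) continuous_id'
  have c1 (x : ℝ) := continuous_flowSum₁_comp c θ κ (continuous_const (y := α))
    (continuous_const (y := x)) continuous_id'
  have c2 (x : ℝ) := continuous_flowSum₂_comp c θ κ (continuous_const (y := α))
    (continuous_const (y := x)) continuous_id'
  have cI (x : ℝ) : Continuous fun η => powDeriv ε s (flowSum c θ κ α x η)
    (Complex.I * flowSum₁ c θ κ α x η) :=
    continuous_powDeriv s hε (c0 x) (continuous_const.mul (c1 x))
  have cII : Continuous fun η => powDeriv₂ ε s (flowSum c θ κ α ξ η)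
    (Complex.I * flowSum₁ c θ κ α ξ η) :=
    continuous_powDeriv₂ s hε (c0 ξ) (continuous_const.mul (c1 ξ))
  have cK : Continuous fun η => powDeriv ε s (flowSum c θ κ α ξ η) (flowSum₂ c θ κ α ξ η) :=
    continuous_powDeriv s hε (c0 ξ) (c2 ξ)
  have h := (hasDerivAt_integral_of_dominated_loc_of_deriv_le (μ := gauss) (x₀ := ξ)
    (F := fun x η => powDeriv ε s (flowSum c θ κ α x η) (Complex.I * flowSum₁ c θ κ α x η))
    (F' := fun x η => Real.sin α *
        (powDeriv₂ ε s (flowSum c θ κ α x η) (Complex.I * flowSum₁ c θ κ α x η)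
          - powDeriv ε s (flowSum c θ κ α x η) (flowSum₂ c θ κ α x η)))
    (bound := fun η => (4 * s ^ 2 + 2 * s) * flowMajorant c θ κ ε η ^ s)
    univ_mem (Eventually.of_forall fun x => (cI x).aestronglyMeasurable)
    (integrable_of_le_majorant c θ κ hε (cI ξ) (abs_powDeriv_flow_I_le c θ κ hε hs α ξ))
    (by exact (continuous_const.mul (cII.sub cK)).aestronglyMeasurable)
    (Eventually.of_forall fun η x _ => ?_)
    ((integrable_majorant_rpow c θ κ hε s).const_mul _)
    (Eventually.of_forall fun η x _ => ?_)).2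
  · refine h.congr_deriv ?_
    rw [integral_const_mul, integral_sub]
    · rfl
    · exact integrable_of_le_majorant c θ κ hε cII (abs_powDeriv₂_flow_I_le c θ κ hε hs α ξ)
    · exact integrable_of_le_majorant c θ κ hε cK (abs_powDeriv_flow₂_le c θ κ hε hs α ξ)
  · rw [Real.norm_eq_abs, abs_mul]
    refine (mul_le_of_le_one_left (abs_nonneg _) (Real.abs_sin_le_one α)).trans
      ((abs_sub _ _).trans ?_)
    rw [add_mul]
    exact add_le_add (abs_powDeriv₂_flow_I_le c θ κ hε hs α x η)
      (abs_powDeriv_flow₂_le c θ κ hε hs α x η)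
  · have h1 : HasDerivAt (fun x => Complex.I * flowSum₁ c θ κ α x η)
        (((-Real.sin α : ℝ) : ℂ) * flowSum₂ c θ κ α x η) x := by
      refine ((hasDerivAt_flowSum₁_snd c θ κ α x η).const_mul Complex.I).congr_deriv ?_
      push_cast
      linear_combination (Complex.sin α * flowSum₂ c θ κ α x η) * Complex.I_sq
    refine (hasDerivAt_powDeriv s hε (hasDerivAt_flowSum_snd c θ κ α x η) h1).congr_deriv ?_
    rw [powDeriv_ofReal_mul]
    simp only [flowSum₁]
    ring

end Flow

/-! ### Monotonicity of the outer mean -/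

section Flow

variable {ι : Type*} [Fintype ι] (c : ι → ℂ) (θ : ι → ℝ) (κ : ℝ) {ε s : ℝ}

lemma flowH_le (hε : 0 < ε) (hs : 1 ≤ s) (α ξ : ℝ) :
    flowH c θ κ ε s α ξ ≤ ∫ η, flowMajorant c θ κ ε η ^ s ∂gauss :=
  integral_mono_of_nonneg
    (Eventually.of_forall fun η => Real.rpow_nonneg (normSq_add_pos _ hε).le _)
    (integrable_majorant_rpow c θ κ hε s)
    (Eventually.of_forall fun η => normSq_flowSum_add_rpow_le c θ κ hε (by linarith) α ξ η)

lemma integrable_normSq_flowSum_add_rpow (hε : 0 < ε) (hs : 1 ≤ s) (α ξ : ℝ) :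
    Integrable (fun η => (Complex.normSq (flowSum c θ κ α ξ η) + ε) ^ s) gauss := by
  refine integrable_of_le_majorant c θ κ (s := s) (C := 1) hε
    (continuous_normSq_flowSum_add_rpow c θ κ hε s continuous_const continuous_const
      continuous_id') fun η => ?_
  rw [abs_of_nonneg (Real.rpow_nonneg (normSq_add_pos _ hε).le _), one_mul]
  exact normSq_flowSum_add_rpow_le c θ κ hε (by linarith) α ξ η

lemma rpow_le_flowH (hε : 0 < ε) (hs : 1 ≤ s) (α ξ : ℝ) :
    ε ^ s ≤ flowH c θ κ ε s α ξ := by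
  have h : ∫ _, ε ^ s ∂gauss ≤ flowH c θ κ ε s α ξ :=
    integral_mono (integrable_const _) (integrable_normSq_flowSum_add_rpow c θ κ hε hs α ξ)
      fun η => Real.rpow_le_rpow hε.le (le_add_of_nonneg_left (Complex.normSq_nonneg _))
        (by linarith)
  simpa using h

lemma flowH_pos (hε : 0 < ε) (hs : 1 ≤ s) (α ξ : ℝ) : 0 < flowH c θ κ ε s α ξ :=
  (Real.rpow_pos_of_pos hε s).trans_le (rpow_le_flowH c θ κ hε hs α ξ)

lemma abs_flowM_le (hε : 0 < ε) (hs : 1 ≤ s) (α ξ : ℝ) :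
    |flowM c θ κ ε s α ξ| ≤ 2 * s * ∫ η, flowMajorant c θ κ ε η ^ s ∂gauss :=
  abs_integral_le_of_le_majorant c θ κ hε (abs_powDeriv_flow_I_le c θ κ hε hs α ξ)

lemma abs_flowK_le (hε : 0 < ε) (hs : 1 ≤ s) (α ξ : ℝ) :
    |flowK c θ κ ε s α ξ| ≤ 2 * s * ∫ η, flowMajorant c θ κ ε η ^ s ∂gauss :=
  abs_integral_le_of_le_majorant c θ κ hε (abs_powDeriv_flow₂_le c θ κ hε hs α ξ)

lemma abs_flowDI_le (hε : 0 < ε) (hs : 1 ≤ s) (α ξ : ℝ) :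
    |flowDI c θ κ ε s α ξ| ≤ 4 * s ^ 2 * ∫ η, flowMajorant c θ κ ε η ^ s ∂gauss :=
  abs_integral_le_of_le_majorant c θ κ hε (abs_powDeriv₂_flow_I_le c θ κ hε hs α ξ)

lemma abs_flowD_le (hε : 0 < ε) (hs : 1 ≤ s) (α ξ : ℝ) :
    |flowD c θ κ ε s α ξ| ≤ 4 * s ^ 2 * ∫ η, flowMajorant c θ κ ε η ^ s ∂gauss :=
  abs_integral_le_of_le_majorant c θ κ hε (abs_powDeriv₂_flow_le c θ κ hε hs α ξ)

lemma measurable_integral_of_continuous {f : ℝ × ℝ → ℝ} (hf : Continuous f) :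
    Measurable fun x => ∫ y, f (x, y) ∂gauss :=
  hf.stronglyMeasurable.integral_prod_right'.measurable

lemma measurable_flowH (hε : 0 < ε) (s α : ℝ) : Measurable (flowH c θ κ ε s α) :=
  measurable_integral_of_continuous (continuous_normSq_flowSum_add_rpow c θ κ hε s
    (continuous_const (y := α)) continuous_fst continuous_snd)

lemma measurable_flowM (hε : 0 < ε) (s α : ℝ) : Measurable (flowM c θ κ ε s α) :=
  measurable_integral_of_continuous (continuous_powDeriv s hε
    (continuous_flowSum_comp θ κ c (continuous_const (y := α)) continuous_fst continuous_snd)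
    (continuous_const.mul (continuous_flowSum₁_comp c θ κ (continuous_const (y := α))
      continuous_fst continuous_snd)))

lemma measurable_flowK (hε : 0 < ε) (s α : ℝ) : Measurable (flowK c θ κ ε s α) :=
  measurable_integral_of_continuous (continuous_powDeriv s hε
    (continuous_flowSum_comp θ κ c (continuous_const (y := α)) continuous_fst continuous_snd)
    (continuous_flowSum₂_comp c θ κ (continuous_const (y := α))
      continuous_fst continuous_snd))

lemma measurable_flowDI (hε : 0 < ε) (s α : ℝ) : Measurable (flowDI c θ κ ε s α) :=
  measurable_integral_of_continuous (continuous_powDeriv₂ s hε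
    (continuous_flowSum_comp θ κ c (continuous_const (y := α)) continuous_fst continuous_snd)
    (continuous_const.mul (continuous_flowSum₁_comp c θ κ (continuous_const (y := α))
      continuous_fst continuous_snd)))

lemma measurable_flowD (hε : 0 < ε) (s α : ℝ) : Measurable (flowD c θ κ ε s α) :=
  measurable_integral_of_continuous (continuous_powDeriv₂ s hε
    (continuous_flowSum_comp θ κ c (continuous_const (y := α)) continuous_fst continuous_snd)
    (continuous_flowSum₁_comp c θ κ (continuous_const (y := α))
      continuous_fst continuous_snd))

/-- The Cauchy-Schwarz step. -/
lemma flowM_sq_le {p : ℝ} (hε : 0 < ε) (hs : 1 ≤ s) (hp2 : p ≤ 2) (hκ : κ ^ 2 = p - 1)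
    (hsp : (2 * s - 1) * (p - 1) = 1) (α ξ : ℝ) :
    (1 - p / (2 * s)) * flowM c θ κ ε s α ξ ^ 2 ≤
      flowH c θ κ ε s α ξ * (flowDI c θ κ ε s α ξ - κ ^ 2 * flowD c θ κ ε s α ξ) := by
  have hH := flowH_pos c θ κ hε hs α ξ
  have c0 := continuous_flowSum_comp θ κ c (continuous_const (y := α)) (continuous_const (y := ξ))
    continuous_id'
  have c1 := continuous_flowSum₁_comp c θ κ (continuous_const (y := α)) (continuous_const (y := ξ))
    continuous_id'
  have iM := integrable_of_le_majorant c θ κ hε (continuous_powDeriv s hε c0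
    (continuous_const.mul c1)) (abs_powDeriv_flow_I_le c θ κ hε hs α ξ)
  have iDI := integrable_of_le_majorant c θ κ hε (continuous_powDeriv₂ s hε c0
    (continuous_const.mul c1)) (abs_powDeriv₂_flow_I_le c θ κ hε hs α ξ)
  have iD := integrable_of_le_majorant c θ κ hε (continuous_powDeriv₂ s hε c0 c1)
    (abs_powDeriv₂_flow_le c θ κ hε hs α ξ)
  have iH := integrable_normSq_flowSum_add_rpow c θ κ hε hs α ξ
  -- Cauchy–Schwarz is used in linearised form: x² ≥ 2lρx − l²ρ² for every l. After integration the
  -- lower bound is a multiple of (l/s) M − l² H, which is largest at this l.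
  set l := flowM c θ κ ε s α ξ / (2 * s * flowH c θ κ ε s α ξ) with hl
  have hcoef : 0 ≤ 2 * s * (2 * s - p) := by
    have : 0 ≤ 2 * s - p := by linarith
    positivity
  have hpt : ∀ η, 2 * s * (2 * s - p) * (l / s * powDeriv ε s (flowSum c θ κ α ξ η)
        (Complex.I * flowSum₁ c θ κ α ξ η)
          - l ^ 2 * (Complex.normSq (flowSum c θ κ α ξ η) + ε) ^ s)
      ≤ powDeriv₂ ε s (flowSum c θ κ α ξ η) (Complex.I * flowSum₁ c θ κ α ξ η)
        - κ ^ 2 * powDeriv₂ ε s (flowSum c θ κ α ξ η) (flowSum₁ c θ κ α ξ η) := by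
    intro η
    rw [hκ]
    refine le_trans ?_ (powDeriv₂_I_mul_sub_ge _ _ hε hs hp2 hsp)
    refine mul_le_mul_of_nonneg_left ?_ hcoef
    simp only [powDeriv]
    set ρ := Complex.normSq (flowSum c θ κ α ξ η) + ε with hρ'
    have hρ : 0 < ρ := normSq_add_pos _ hε
    set x := (Complex.I * flowSum₁ c θ κ α ξ η * conj (flowSum c θ κ α ξ η)).re
    have e1 : ρ ^ (s - 1) = ρ ^ (s - 2) * ρ := by
      rw [← Real.rpow_add_one hρ.ne']; congr 1; ring
    have e2 : ρ ^ s = ρ ^ (s - 2) * ρ * ρ := by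
      rw [← e1, ← Real.rpow_add_one hρ.ne']; congr 1; ring
    have hX : 0 ≤ ρ ^ (s - 2) := Real.rpow_nonneg hρ.le _
    have := mul_nonneg hX (sq_nonneg (x - l * ρ))
    rw [e1, e2]
    have hs0 : s ≠ 0 := by linarith
    field_simp
    nlinarith
  have hint := integral_mono (((iM.const_mul (l / s)).sub (iH.const_mul (l ^ 2))).const_mul
    (2 * s * (2 * s - p))) (iDI.sub (iD.const_mul (κ ^ 2))) hpt
  simp only [Pi.sub_apply] at hint
  rw [integral_const_mul, integral_sub (iM.const_mul _) (iH.const_mul _), integral_const_mul,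
    integral_const_mul, integral_sub iDI (iD.const_mul _), integral_const_mul] at hint
  change 2 * s * (2 * s - p) * (l / s * flowM c θ κ ε s α ξ - l ^ 2 * flowH c θ κ ε s α ξ) ≤
    flowDI c θ κ ε s α ξ - κ ^ 2 * flowD c θ κ ε s α ξ at hint
  refine le_trans (le_of_eq ?_) (mul_le_mul_of_nonneg_left hint hH.le)
  have hs0 : s ≠ 0 := by linarith
  rw [hl]
  field_simp
  ring

/-- The quantity that is monotone along the flow. -/
def flowG (ε s t α : ℝ) : ℝ := ∫ ξ, flowH c θ κ ε s α ξ ^ t ∂gauss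

/-- One purpose of the regularisation: the powers of H with exponents t − 1 and t − 2 that occur in
the derivative of the outer mean are nonpositive, and H ≥ ε^s keeps them bounded. -/
lemma flowH_rpow_le (hε : 0 < ε) (hs : 1 ≤ s) {t : ℝ} (ht : t ≤ 0) (α ξ : ℝ) :
    flowH c θ κ ε s α ξ ^ t ≤ (ε ^ s) ^ t :=
  Real.rpow_le_rpow_of_nonpos (Real.rpow_pos_of_pos hε s) (rpow_le_flowH c θ κ hε hs α ξ) ht

lemma integrable_flowH_rpow_mul (hε : 0 < ε) (hs : 1 ≤ s) {t C : ℝ} (ht : t ≤ 0) (α : ℝ)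
    {g : ℝ → ℝ} (hg : Measurable g) (hC : ∀ ξ, |g ξ| ≤ C) :
    Integrable (fun ξ => flowH c θ κ ε s α ξ ^ t * g ξ) gauss := by
  refine (integrable_const ((ε ^ s) ^ t * C)).mono'
    (((measurable_flowH c θ κ hε s α).pow_const t).mul hg).aestronglyMeasurable
    (Eventually.of_forall fun ξ => ?_)
  have := (flowH_pos c θ κ hε hs α ξ).le
  rw [norm_mul, Real.norm_of_nonneg (by positivity)]
  exact mul_le_mul (flowH_rpow_le c θ κ hε hs ht α ξ) (hC ξ) (abs_nonneg _) (by positivity)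

lemma integrable_id_mul_flowH_rpow_mul (hε : 0 < ε) (hs : 1 ≤ s) {t C : ℝ} (ht : t ≤ 0) (α : ℝ)
    {g : ℝ → ℝ} (hg : Measurable g) (hC : ∀ ξ, |g ξ| ≤ C) :
    Integrable (fun ξ => ξ * (flowH c θ κ ε s α ξ ^ t * g ξ)) gauss := by
  refine (integrable_abs_gauss.mul_const ((ε ^ s) ^ t * C)).mono'
    (measurable_id.mul
      (((measurable_flowH c θ κ hε s α).pow_const t).mul hg)).aestronglyMeasurable
    (Eventually.of_forall fun ξ => ?_)
  have := (flowH_pos c θ κ hε hs α ξ).le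
  rw [norm_mul, norm_mul, Real.norm_of_nonneg (by positivity : 0 ≤ flowH c θ κ ε s α ξ ^ t),
    Real.norm_eq_abs]
  exact mul_le_mul_of_nonneg_left (mul_le_mul (flowH_rpow_le c θ κ hε hs ht α ξ) (hC ξ)
    (abs_nonneg _) (by positivity)) (abs_nonneg _)

/-- Integration by parts in the outer variable. -/
lemma integral_id_mul_flowH_rpow_mul (hε : 0 < ε) (hs : 1 ≤ s) {t : ℝ} (ht1 : t ≤ 1) (α : ℝ) :
    ∫ ξ, ξ * (flowH c θ κ ε s α ξ ^ (t - 1) * flowM c θ κ ε s α ξ) ∂gauss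
      = Real.sin α * ((t - 1) * ∫ ξ, flowH c θ κ ε s α ξ ^ (t - 2) * flowM c θ κ ε s α ξ ^ 2 ∂gauss
        + ∫ ξ, flowH c θ κ ε s α ξ ^ (t - 1) *
            (flowDI c θ κ ε s α ξ - flowK c θ κ ε s α ξ) ∂gauss) := by
  have i1 := integrable_flowH_rpow_mul c θ κ hε hs (t := t - 1) (by linarith) α
    (measurable_flowM c θ κ hε s α) (abs_flowM_le c θ κ hε hs α)
  have i2 := integrable_id_mul_flowH_rpow_mul c θ κ hε hs (t := t - 1) (by linarith) α
    (measurable_flowM c θ κ hε s α) (abs_flowM_le c θ κ hε hs α)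
  have i3 := integrable_flowH_rpow_mul c θ κ hε hs (t := t - 2) (by linarith) α
    ((measurable_flowM c θ κ hε s α).pow_const 2)
    (C := (2 * s * ∫ η, flowMajorant c θ κ ε η ^ s ∂gauss) ^ 2) (fun ξ => by
      rw [abs_pow]
      exact pow_le_pow_left₀ (abs_nonneg _) (abs_flowM_le c θ κ hε hs α ξ) 2)
  have i4 : Integrable (fun ξ => flowH c θ κ ε s α ξ ^ (t - 1) *
      (flowDI c θ κ ε s α ξ - flowK c θ κ ε s α ξ)) gauss :=
    integrable_flowH_rpow_mul c θ κ hε hs (t := t - 1) (by linarith) α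
    ((measurable_flowDI c θ κ hε s α).sub (measurable_flowK c θ κ hε s α))
    (fun ξ => (abs_sub _ _).trans
      (add_le_add (abs_flowDI_le c θ κ hε hs α ξ) (abs_flowK_le c θ κ hε hs α ξ)))
  have i5 : Integrable (fun ξ => Real.sin α *
      ((t - 1) * (flowH c θ κ ε s α ξ ^ (t - 2) * flowM c θ κ ε s α ξ ^ 2)
        + flowH c θ κ ε s α ξ ^ (t - 1) * (flowDI c θ κ ε s α ξ - flowK c θ κ ε s α ξ))) gauss :=
    ((i3.const_mul (t - 1)).add i4).const_mul (Real.sin α)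
  rw [integral_id_mul_gauss (fun ξ => ?_) i1 i5 i2]
  · rw [integral_const_mul, integral_add (i3.const_mul _) i4, integral_const_mul]
  · refine (((hasDerivAt_flowH_snd c θ κ hε hs α ξ).rpow_const (p := t - 1)
      (Or.inl (flowH_pos c θ κ hε hs α ξ).ne')).mul
      (hasDerivAt_flowM_snd c θ κ hε hs α ξ)).congr_deriv ?_
    have e : t - 1 - 1 = t - 2 := by ring
    rw [e]
    ring

/-- Integrating the ξ M term by parts gives DI − K together with (t − 1) M²/H. The K cancels against
that in the α-derivative of H, leaving only quantities controlled by `flowM_sq_le`. -/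
lemma hasDerivAt_flowG (hε : 0 < ε) (hs : 1 ≤ s) {t : ℝ} (ht0 : 0 ≤ t) (ht1 : t ≤ 1) (α : ℝ) :
    HasDerivAt (flowG c θ κ ε s t)
      (t * (Real.sin α * Real.cos α) * ∫ ξ, flowH c θ κ ε s α ξ ^ (t - 2) *
        (flowH c θ κ ε s α ξ * (flowDI c θ κ ε s α ξ - κ ^ 2 * flowD c θ κ ε s α ξ)
          - (1 - t) * flowM c θ κ ε s α ξ ^ 2) ∂gauss) α := by
  set Q := ∫ η, flowMajorant c θ κ ε η ^ s ∂gauss with hQ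
  have hQ0 : 0 ≤ Q := (flowH_pos c θ κ hε hs 0 0).le.trans (flowH_le c θ κ hε hs 0 0)
  have i1 := integrable_id_mul_flowH_rpow_mul c θ κ hε hs (t := t - 1) (by linarith) α
    (measurable_flowM c θ κ hε s α) (abs_flowM_le c θ κ hε hs α)
  have hb : ∀ a ξ, |flowK c θ κ ε s a ξ - κ ^ 2 * flowD c θ κ ε s a ξ|
      ≤ 2 * s * Q + κ ^ 2 * (4 * s ^ 2 * Q) := fun a ξ => by
    refine (abs_sub _ _).trans (add_le_add (abs_flowK_le c θ κ hε hs a ξ) ?_)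
    rw [abs_mul, abs_of_nonneg (sq_nonneg κ)]
    exact mul_le_mul_of_nonneg_left (abs_flowD_le c θ κ hε hs a ξ) (sq_nonneg κ)
  have hmes (a : ℝ) : Measurable fun ξ => flowK c θ κ ε s a ξ - κ ^ 2 * flowD c θ κ ε s a ξ :=
    (measurable_flowK c θ κ hε s a).sub ((measurable_flowD c θ κ hε s a).const_mul _)
  have i2 := integrable_flowH_rpow_mul c θ κ hε hs (t := t - 1) (by linarith) α (hmes α) (hb α)
  have i3 := integrable_flowH_rpow_mul c θ κ hε hs (t := t - 2) (by linarith) α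
    ((measurable_flowM c θ κ hε s α).pow_const 2)
    (C := (2 * s * ∫ η, flowMajorant c θ κ ε η ^ s ∂gauss) ^ 2) (fun ξ => by
      rw [abs_pow]
      exact pow_le_pow_left₀ (abs_nonneg _) (abs_flowM_le c θ κ hε hs α ξ) 2)
  have i4 : Integrable (fun ξ => flowH c θ κ ε s α ξ ^ (t - 1) *
      (flowDI c θ κ ε s α ξ - flowK c θ κ ε s α ξ)) gauss :=
    integrable_flowH_rpow_mul c θ κ hε hs (t := t - 1) (by linarith) α
    ((measurable_flowDI c θ κ hε s α).sub (measurable_flowK c θ κ hε s α))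
    (fun ξ => (abs_sub _ _).trans
      (add_le_add (abs_flowDI_le c θ κ hε hs α ξ) (abs_flowK_le c θ κ hε hs α ξ)))
  have h := (hasDerivAt_integral_of_dominated_loc_of_deriv_le (μ := gauss) (x₀ := α)
    (F := fun a ξ => flowH c θ κ ε s a ξ ^ t)
    (F' := fun a ξ => t * Real.cos a *
        (ξ * (flowH c θ κ ε s a ξ ^ (t - 1) * flowM c θ κ ε s a ξ))
      + t * (Real.sin a * Real.cos a) * (flowH c θ κ ε s a ξ ^ (t - 1) *
        (flowK c θ κ ε s a ξ - κ ^ 2 * flowD c θ κ ε s a ξ)))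
    (bound := fun ξ => t * (|ξ| * ((ε ^ s) ^ (t - 1) * (2 * s * Q)))
      + t * ((ε ^ s) ^ (t - 1) * (2 * s * Q + κ ^ 2 * (4 * s ^ 2 * Q))))
    univ_mem (Eventually.of_forall fun a =>
      ((measurable_flowH c θ κ hε s a).pow_const t).aestronglyMeasurable)
    ((integrable_const (Q ^ t)).mono'
      ((measurable_flowH c θ κ hε s α).pow_const t).aestronglyMeasurable
      (Eventually.of_forall fun ξ => ?_))
    ((i1.const_mul _).add (i2.const_mul _)).aestronglyMeasurable
    (Eventually.of_forall fun ξ a _ => ?_)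
    (((integrable_abs_gauss.mul_const _).const_mul _).add (integrable_const _))
    (Eventually.of_forall fun ξ a _ => ?_)).2
  · refine h.congr_deriv ?_
    rw [integral_add (i1.const_mul _) (i2.const_mul _), integral_const_mul, integral_const_mul,
      integral_id_mul_flowH_rpow_mul c θ κ hε hs ht1 α]
    have e : (fun ξ => flowH c θ κ ε s α ξ ^ (t - 2) *
        (flowH c θ κ ε s α ξ * (flowDI c θ κ ε s α ξ - κ ^ 2 * flowD c θ κ ε s α ξ)
          - (1 - t) * flowM c θ κ ε s α ξ ^ 2))
        = fun ξ => ((t - 1) * (flowH c θ κ ε s α ξ ^ (t - 2) * flowM c θ κ ε s α ξ ^ 2)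
          + flowH c θ κ ε s α ξ ^ (t - 1) * (flowDI c θ κ ε s α ξ - flowK c θ κ ε s α ξ))
          + flowH c θ κ ε s α ξ ^ (t - 1) *
            (flowK c θ κ ε s α ξ - κ ^ 2 * flowD c θ κ ε s α ξ) := by
      funext ξ
      have e1 : flowH c θ κ ε s α ξ ^ (t - 1)
          = flowH c θ κ ε s α ξ ^ (t - 2) * flowH c θ κ ε s α ξ := by
        rw [← Real.rpow_add_one (flowH_pos c θ κ hε hs α ξ).ne']; congr 1; ring
      rw [e1]
      ring
    have i5 : Integrable (fun ξ =>
        (t - 1) * (flowH c θ κ ε s α ξ ^ (t - 2) * flowM c θ κ ε s α ξ ^ 2)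
          + flowH c θ κ ε s α ξ ^ (t - 1) * (flowDI c θ κ ε s α ξ - flowK c θ κ ε s α ξ)) gauss :=
      (i3.const_mul _).add i4
    rw [e, integral_add i5 i2, integral_add (i3.const_mul _) i4,
      integral_const_mul]
    ring
  · have hH := (flowH_pos c θ κ hε hs α ξ).le
    rw [Real.norm_of_nonneg (Real.rpow_nonneg hH _)]
    exact Real.rpow_le_rpow hH (flowH_le c θ κ hε hs α ξ) ht0
  · have hH := (flowH_pos c θ κ hε hs a ξ).le
    have hpow := flowH_rpow_le c θ κ hε hs (t := t - 1) (by linarith) a ξ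
    have hc := Real.abs_cos_le_one a
    have hsc : |Real.sin a * Real.cos a| ≤ 1 := by
      rw [abs_mul]
      exact mul_le_one₀ (Real.abs_sin_le_one a) (abs_nonneg _) hc
    refine (norm_add_le _ _).trans (add_le_add ?_ ?_)
    · rw [Real.norm_eq_abs, abs_mul, abs_mul, abs_mul, abs_mul, abs_of_nonneg ht0,
        abs_of_nonneg (Real.rpow_nonneg hH _)]
      gcongr
      · exact mul_le_of_le_one_right ht0 hc
      · exact abs_flowM_le c θ κ hε hs a ξ
    · rw [Real.norm_eq_abs, abs_mul, abs_mul t, abs_mul (_ ^ (t - 1)), abs_of_nonneg ht0,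
        abs_of_nonneg (Real.rpow_nonneg hH _)]
      gcongr
      · exact mul_le_of_le_one_right ht0 hsc
      · exact hb a ξ
  · refine ((hasDerivAt_flowH_fst c θ κ hε hs a ξ).rpow_const (p := t)
      (Or.inl (flowH_pos c θ κ hε hs a ξ).ne')).congr_deriv ?_
    ring

/-- For the exponent t = p/(2s), the coefficient 1 − t in the derivative is precisely the constant
of `flowM_sq_le`, and sin α cos α ≥ 0 on the quarter turn. -/
lemma flowG_zero_le_flowG_pi_div_two {p : ℝ} (hε : 0 < ε) (hs : 1 ≤ s) (hp0 : 0 < p) (hp2 : p ≤ 2)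
    (hκ : κ ^ 2 = p - 1) (hsp : (2 * s - 1) * (p - 1) = 1) :
    flowG c θ κ ε s (p / (2 * s)) 0 ≤ flowG c θ κ ε s (p / (2 * s)) (Real.pi / 2) := by
  have ht0 : 0 ≤ p / (2 * s) := by positivity
  have ht1 : p / (2 * s) ≤ 1 := by rw [div_le_one (by positivity)]; linarith
  have hder := hasDerivAt_flowG c θ κ hε hs ht0 ht1
  refine monotoneOn_of_deriv_nonneg (convex_Icc 0 (Real.pi / 2))
    (fun α _ => (hder α).continuousAt.continuousWithinAt)
    (fun α _ => (hder α).differentiableAt.differentiableWithinAt) (fun α hα => ?_)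
    (Set.left_mem_Icc.2 (by positivity)) (Set.right_mem_Icc.2 (by positivity)) (by positivity)
  rw [interior_Icc] at hα
  rw [(hder α).deriv]
  have hsin : 0 ≤ Real.sin α := Real.sin_nonneg_of_nonneg_of_le_pi hα.1.le
    (by linarith [hα.2, Real.pi_pos])
  have hcos : 0 ≤ Real.cos α := Real.cos_nonneg_of_mem_Icc ⟨by linarith [hα.1, Real.pi_pos], hα.2.le⟩
  refine mul_nonneg (by positivity) (integral_nonneg fun ξ => ?_)
  exact mul_nonneg (Real.rpow_nonneg (flowH_pos c θ κ hε hs α ξ).le _)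
    (sub_nonneg.2 (flowM_sq_le c θ κ hε hs hp2 hκ hsp α ξ))

end Flow

/-! ### Hypercontractivity read off at the two ends of the flow -/

section Transfer

variable {ι : Type*} [Fintype ι] (c : ι → ℂ) (θ : ι → ℝ)

lemma norm_rpow_two_mul (w : ℂ) (s : ℝ) : ‖w‖ ^ (2 * s) = Complex.normSq w ^ s := by
  rw [Complex.normSq_eq_norm_sq, Real.rpow_mul (norm_nonneg _)]
  norm_cast

lemma flowSum_zero (κ ξ η : ℝ) :
    flowSum c θ κ 0 ξ η = heatSum c θ (Complex.I * κ * η) ((1 + κ ^ 2) / 2) := by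
  simp [flowSum, flowZ, flowR]

lemma flowSum_pi_div_two (κ ξ η : ℝ) :
    flowSum c θ κ (Real.pi / 2) ξ η = heatSum c θ ξ 0 := by
  simp [flowSum, flowZ, flowR]

lemma continuous_heatSum {X : Type*} [TopologicalSpace X] {z : X → ℂ} (hz : Continuous z) (r : ℝ) :
    Continuous fun x => heatSum c θ (z x) r := by
  unfold heatSum
  fun_prop

lemma norm_heatSum_ofReal_le (x : ℝ) : ‖heatSum c θ x 0‖ ≤ ∑ j, ‖c j‖ := by
  simpa using norm_heatSum_le c θ x le_rfl

lemma integrable_norm_heatSum_I_rpow (κ : ℝ) {r q : ℝ} (hr : 0 ≤ r) (hq : 0 ≤ q) :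
    Integrable (fun η : ℝ => ‖heatSum c θ (Complex.I * κ * η) r‖ ^ q) gauss := by
  refine ((integrable_exp_mul_abs_gauss ((∑ j, |θ j|) * |κ| * q)).const_mul
    ((∑ j, ‖c j‖) ^ q)).mono' ?_ (Eventually.of_forall fun η => ?_)
  · exact ((continuous_heatSum c θ (by fun_prop) r).norm.rpow_const
      fun _ => Or.inr hq).aestronglyMeasurable
  · rw [Real.norm_of_nonneg (by positivity)]
    have h := Real.rpow_le_rpow (norm_nonneg _)
      (norm_heatSum_le c θ (Complex.I * κ * η) hr) hq
    rw [Real.mul_rpow (by positivity) (Real.exp_pos _).le, ← Real.exp_mul] at h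
    have him : (Complex.I * κ * η).im = κ * η := by simp [Complex.mul_im]
    rw [him, abs_mul] at h
    refine h.trans_eq ?_
    congr 2
    ring

lemma integrable_norm_heatSum_ofReal_rpow {p : ℝ} (hp : 0 ≤ p) :
    Integrable (fun ξ : ℝ => ‖heatSum c θ ξ 0‖ ^ p) gauss := by
  refine (integrable_const ((∑ j, ‖c j‖) ^ p)).mono' ?_ (Eventually.of_forall fun ξ => ?_)
  · exact ((continuous_heatSum c θ (by fun_prop) 0).norm.rpow_const
      fun _ => Or.inr hp).aestronglyMeasurable
  · rw [Real.norm_of_nonneg (by positivity)]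
    exact Real.rpow_le_rpow (norm_nonneg _) (norm_heatSum_ofReal_le c θ ξ) hp

/-- Complex Gaussian hypercontractivity for exponential sums. -/
lemma integral_norm_heatSum_rpow_le {p q κ : ℝ} (hp1 : 1 < p) (hp2 : p ≤ 2)
    (hκ : κ ^ 2 = p - 1) (hpq : (p - 1) * (q - 1) = 1) :
    (∫ η : ℝ, ‖heatSum c θ (Complex.I * κ * η) (p / 2)‖ ^ q ∂gauss) ^ (p / q)
      ≤ ∫ ξ : ℝ, ‖heatSum c θ ξ 0‖ ^ p ∂gauss := by
  obtain ⟨s, rfl⟩ : ∃ s, q = 2 * s := ⟨q / 2, by ring⟩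
  have hs : 1 ≤ s := by nlinarith
  have hp0 : 0 < p := by linarith
  have iq := integrable_norm_heatSum_I_rpow c θ κ (r := p / 2) (q := 2 * s) (by positivity)
    (by positivity)
  have ip := integrable_norm_heatSum_ofReal_rpow c θ hp0.le
  refine le_of_forall_pos_le_add fun δ hδ => ?_
  -- Chosen so that ε^(p/2) = δ. As p/2 ≤ 1, the power is subadditive, so (|w|² + ε)^(p/2) ≤ |w|^p +
  -- δ at the end α = π/2.
  set ε := δ ^ (2 / p) with hε'
  have hε : 0 < ε := Real.rpow_pos_of_pos hδ _
  have hεδ : ε ^ (p / 2) = δ := by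
    rw [hε', ← Real.rpow_mul hδ.le]
    convert Real.rpow_one δ using 2
    field_simp
  have h := flowG_zero_le_flowG_pi_div_two c θ κ hε hs hp0 hp2 hκ (by linarith)
  have hL : (∫ η : ℝ, ‖heatSum c θ (Complex.I * κ * η) (p / 2)‖ ^ (2 * s) ∂gauss) ^ (p / (2 * s))
      ≤ flowG c θ κ ε s (p / (2 * s)) 0 := by
    have e : ∀ ξ, flowH c θ κ ε s 0 ξ = flowH c θ κ ε s 0 0 := fun ξ => by
      simp only [flowH, flowSum_zero]
    simp only [flowG, e, integral_const, probReal_univ, one_smul]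
    refine Real.rpow_le_rpow (integral_nonneg fun η => by positivity) ?_ (by positivity)
    refine integral_mono iq (integrable_normSq_flowSum_add_rpow c θ κ hε hs 0 0) fun η => ?_
    have e2 : (1 + κ ^ 2) / 2 = p / 2 := by rw [hκ]; ring
    simp only [norm_rpow_two_mul, flowSum_zero, e2]
    exact Real.rpow_le_rpow (Complex.normSq_nonneg _) (by linarith) (by linarith)
  have hR : flowG c θ κ ε s (p / (2 * s)) (Real.pi / 2)
      ≤ ∫ ξ : ℝ, ‖heatSum c θ ξ 0‖ ^ p ∂gauss + δ := by
    have e : ∫ ξ : ℝ, (‖heatSum c θ ξ 0‖ ^ p + δ) ∂gauss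
        = ∫ ξ : ℝ, ‖heatSum c θ ξ 0‖ ^ p ∂gauss + δ := by
      rw [integral_add ip (integrable_const _)]
      simp
    rw [← e]
    refine integral_mono_of_nonneg (Eventually.of_forall fun ξ =>
      Real.rpow_nonneg (flowH_pos c θ κ hε hs _ ξ).le _) (ip.add (integrable_const _))
      (Eventually.of_forall fun ξ => ?_)
    have hn := normSq_add_pos (heatSum c θ ξ 0) hε
    have hn2 : ‖heatSum c θ ξ 0‖ ^ p = Complex.normSq (heatSum c θ ξ 0) ^ (p / 2) := by
      rw [← norm_rpow_two_mul]; congr 1; ring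
    simp only [flowH, flowSum_pi_div_two, integral_const, probReal_univ, one_smul]
    have e3 : s * (p / (2 * s)) = p / 2 := by field_simp
    rw [← Real.rpow_mul hn.le, hn2, ← hεδ, e3]
    exact Real.rpow_add_le_add_rpow (Complex.normSq_nonneg (heatSum c θ ξ 0)) hε.le
      (by positivity : 0 ≤ p / 2) (by linarith)
  exact hL.trans (h.trans hR)

/-! ### From the Gaussian to Lebesgue measure -/

/-- The Fourier transform on the line with kernel `e^{-isx}`. -/
def lineFourier (g : ℝ → ℂ) (s : ℝ) : ℂ := ∫ x : ℝ, Complex.exp (-Complex.I * s * x) * g x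

/-- An exponential sum with Gaussian damping. -/
def dampedSum (p x : ℝ) : ℂ := heatSum c θ x 0 * (Real.exp (-x ^ 2 / (2 * p)) : ℝ)

lemma continuous_dampedSum (p : ℝ) : Continuous (dampedSum c θ p) := by
  have h : Continuous fun x : ℝ => heatSum c θ x 0 := continuous_heatSum c θ (by fun_prop) 0
  unfold dampedSum
  fun_prop

/-- Term by term, exp(iθx − x²/2p) has transform √(2πp) exp(−p(s − θ)²/2). Expanding the square
splits off exp(−ps²/2) and leaves exp(pθs − θ²p/2), which is the heat flow at time p/2 and at z =
iκη with η = −ps/κ. -/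
lemma lineFourier_dampedSum {p κ : ℝ} (hp : 0 < p) (hκ : κ ≠ 0) (s : ℝ) :
    lineFourier (dampedSum c θ p) s = ((2 * Real.pi * p) ^ (1 / 2 : ℝ) *
      Real.exp (-p * s ^ 2 / 2) : ℝ) * heatSum c θ (Complex.I * κ * (-p / κ * s : ℝ)) (p / 2) := by
  have hb : 0 < ((1 / (2 * p) : ℝ) : ℂ).re := by rw [Complex.ofReal_re]; positivity
  have hκ' : (κ : ℂ) ≠ 0 := by exact_mod_cast hκ
  have hp' : (p : ℂ) ≠ 0 := by exact_mod_cast hp.ne'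
  have hint : ∀ t : ℂ, Integrable fun x : ℝ => Complex.exp (Complex.I * t * x) *
      Complex.exp (-((1 / (2 * p) : ℝ) : ℂ) * x ^ 2) := fun t => by
    have := integrable_cexp_quadratic hb (Complex.I * t) 0
    refine this.congr (Eventually.of_forall fun x => ?_)
    simp only [← Complex.exp_add]
    congr 1
    ring
  have hterm : ∀ x : ℝ, Complex.exp (-Complex.I * s * x) * dampedSum c θ p x
      = ∑ j, c j * (Complex.exp (Complex.I * (θ j - s : ℝ) * x) *
        Complex.exp (-((1 / (2 * p) : ℝ) : ℂ) * x ^ 2)) := fun x => by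
    simp only [dampedSum, heatSum, Finset.sum_mul, Finset.mul_sum]
    refine Finset.sum_congr rfl fun j _ => ?_
    have h1 : Complex.exp (Complex.I * θ j * x - (θ j : ℂ) ^ 2 * (0 : ℝ)) *
        (Complex.exp (-Complex.I * s * x) * Complex.exp ((-x ^ 2 / (2 * p) : ℝ) : ℂ))
        = Complex.exp (Complex.I * (θ j - s : ℝ) * x) *
          Complex.exp (-((1 / (2 * p) : ℝ) : ℂ) * x ^ 2) := by
      simp only [← Complex.exp_add]
      congr 1
      push_cast
      field_simp
      ring
    rw [Complex.ofReal_exp]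
    linear_combination c j * h1
  rw [lineFourier, integral_congr_ae (Eventually.of_forall hterm),
    integral_finsetSum _ fun j _ => (hint _).const_mul _]
  simp only [integral_const_mul, fourierIntegral_gaussian hb, heatSum, Finset.mul_sum]
  refine Finset.sum_congr rfl fun j _ => ?_
  have e1 : ((Real.pi : ℂ) / ((1 / (2 * p) : ℝ) : ℂ)) ^ (1 / 2 : ℂ)
      = ((2 * Real.pi * p) ^ (1 / 2 : ℝ) : ℝ) := by
    rw [Complex.ofReal_cpow (by positivity)]
    congr 1
    · push_cast; field_simp
    · push_cast; rfl
  have e2 : Complex.exp (-((θ j - s : ℝ) : ℂ) ^ 2 / (4 * ((1 / (2 * p) : ℝ) : ℂ)))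
      = Complex.exp ((-p * s ^ 2 / 2 : ℝ) : ℂ) * Complex.exp (Complex.I * θ j *
        (Complex.I * κ * (-p / κ * s : ℝ)) - (θ j : ℂ) ^ 2 * (p / 2 : ℝ)) := by
    rw [← Complex.exp_add]
    congr 1
    push_cast
    field_simp
    linear_combination (8 * θ j * s : ℂ) * Complex.I_sq
  rw [e1, e2, Complex.ofReal_mul ((2 * Real.pi * p) ^ (1 / 2 : ℝ)), Complex.ofReal_exp]
  ring

lemma integral_gauss_eq (g : ℝ → ℝ) :
    ∫ x, g x ∂gauss = (√(2 * Real.pi))⁻¹ * ∫ x, Real.exp (-x ^ 2 / 2) * g x := by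
  rw [integral_gaussianReal_eq_integral_smul one_ne_zero, ← integral_const_mul]
  simp only [gaussianPDFReal_zero_one, smul_eq_mul, mul_assoc]

lemma integrable_gauss_iff_exp {g : ℝ → ℝ} :
    Integrable g gauss ↔ Integrable (fun x => Real.exp (-x ^ 2 / 2) * g x) := by
  simp only [integrable_gauss_iff, gaussianPDFReal_zero_one, mul_assoc]
  exact integrable_const_mul_iff (isUnit_iff_ne_zero.2 (by positivity)) _

lemma norm_dampedSum_rpow {p : ℝ} (hp : 0 < p) (x : ℝ) :
    ‖dampedSum c θ p x‖ ^ p = Real.exp (-x ^ 2 / 2) * ‖heatSum c θ x 0‖ ^ p := by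
  rw [dampedSum, norm_mul, Complex.norm_real, Real.norm_of_nonneg (Real.exp_pos _).le,
    Real.mul_rpow (norm_nonneg _) (Real.exp_pos _).le, ← Real.exp_mul, mul_comm]
  congr 2
  field_simp

/-- Since q = p/κ², the q-th power of exp(−ps²/2) is the standard Gaussian weight exp(−η²/2) in the
variable η = −ps/κ. -/
lemma norm_lineFourier_dampedSum_rpow {p q κ : ℝ} (hp : 1 < p)
    (hκ : κ ^ 2 = p - 1) (hpq : (p - 1) * (q - 1) = 1) (s : ℝ) :
    ‖lineFourier (dampedSum c θ p) s‖ ^ q = (2 * Real.pi * p) ^ (q / 2) *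
      (Real.exp (-(-p / κ * s) ^ 2 / 2) *
        ‖heatSum c θ (Complex.I * κ * (-p / κ * s : ℝ)) (p / 2)‖ ^ q) := by
  have hp0 : 0 < p := by linarith
  have hκ0 : κ ≠ 0 := by rintro rfl; linarith
  rw [lineFourier_dampedSum c θ hp0 hκ0, norm_mul, Complex.norm_real,
    Real.norm_of_nonneg (by positivity), Real.mul_rpow (by positivity) (norm_nonneg _),
    Real.mul_rpow (by positivity) (Real.exp_pos _).le, ← Real.exp_mul, ← Real.rpow_mul
    (by positivity), mul_assoc]
  have h1 : q = p / (p - 1) := by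
    have : p - 1 ≠ 0 := by linarith
    field_simp
    linarith
  have h2 : -p * s ^ 2 / 2 * q = -(-p / κ * s) ^ 2 / 2 := by
    rw [mul_pow, div_pow, hκ, h1]
    ring
  rw [h2]
  congr 2
  ring

lemma hausdorffYoungConst_pos {p : ℝ} (hp : 1 < p) : 0 < hausdorffYoungConst p := by
  have h : 1 / p < 1 := by rw [div_lt_one (by linarith)]; exact hp
  have h1 : 0 < 1 - 1 / p := by linarith
  unfold hausdorffYoungConst
  positivity

/-- The left side collects the amplitude √(2πp), the Jacobian κ/p of s ↦ −ps/κ and the Gaussian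
normalisation √(2π); the right side carries the normalisation of the p-norm. Taking logarithms makes
the identity linear, once κ² = p(1 − 1/p) is used. -/
lemma hausdorffYoungConst_identity {p q κ : ℝ} (hp : 1 < p) (hκ0 : 0 < κ)
    (hκ : κ ^ 2 = p - 1) (hpq : (p - 1) * (q - 1) = 1) :
    ((2 * Real.pi * p) ^ (q / 2) * (κ / p * √(2 * Real.pi))) ^ (1 / q)
      = hausdorffYoungConst p * √(2 * Real.pi) ^ (1 / p) := by
  have hp0 : 0 < p := by linarith
  have hq0 : 0 < q := by
    have : 0 < q - 1 := by
      by_contra h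
      nlinarith
    linarith
  have hq : 1 / q = 1 - 1 / p := by
    field_simp
    linarith
  have h1 : 0 < 1 - 1 / p := by rw [← hq]; positivity
  have hC := hausdorffYoungConst_pos hp
  rw [hausdorffYoungConst] at hC ⊢
  have hT : 0 < 2 * Real.pi := by positivity
  generalize 2 * Real.pi = T at hC hT ⊢
  refine Real.log_injOn_pos (Set.mem_Ioi.2 (by positivity)) (Set.mem_Ioi.2 (by positivity)) ?_
  have hlκ : Real.log κ = (Real.log p + Real.log (1 - 1 / p)) / 2 := by
    rw [← Real.log_mul hp0.ne' h1.ne', show p * (1 - 1 / p) = κ ^ 2 by rw [hκ]; field_simp,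
      Real.log_pow]
    push_cast
    ring
  have hl2 : Real.log √T = Real.log T / 2 := Real.log_sqrt hT.le
  rw [Real.log_rpow (by positivity), Real.log_mul (by positivity) (by positivity),
    Real.log_rpow (by positivity), Real.log_mul (by positivity) hp0.ne',
    Real.log_mul (by positivity) (by positivity), Real.log_div hκ0.ne' hp0.ne', hlκ, hl2,
    Real.log_mul hC.ne' (by positivity), Real.log_rpow (by positivity), hl2,
    Real.log_mul (by positivity) (by positivity), Real.log_rpow (by positivity),
    Real.log_rpow (by positivity), Real.log_mul (by positivity) (by positivity),
    Real.log_rpow hp0, Real.log_rpow h1]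
  have e : ∀ x : ℝ, 1 / q * (q / 2 * x) = x / 2 := fun x => by field_simp
  rw [mul_add, e, hq]
  ring

/-- The sharp Hausdorff-Young inequality for damped exponential sums. -/
lemma eLpNorm_lineFourier_dampedSum_le {p q : ℝ} (hp1 : 1 < p) (hp2 : p ≤ 2)
    (hpq : (p - 1) * (q - 1) = 1) :
    eLpNorm (lineFourier (dampedSum c θ p)) (ENNReal.ofReal q) volume
      ≤ ENNReal.ofReal (hausdorffYoungConst p)
        * eLpNorm (dampedSum c θ p) (ENNReal.ofReal p) volume := by
  have hp0 : 0 < p := by linarith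
  have hq0 : 0 < q := by
    have : 0 < q - 1 := by
      by_contra h
      nlinarith
    linarith
  set κ := √(p - 1) with hκdef
  have hκ0 : 0 < κ := Real.sqrt_pos.2 (by linarith)
  have hκ : κ ^ 2 = p - 1 := Real.sq_sqrt (by linarith)
  have hq' : (ENNReal.ofReal q) ≠ 0 := by simpa using hq0
  have hp' : (ENNReal.ofReal p) ≠ 0 := by simpa using hp0
  have iP := integrable_norm_heatSum_ofReal_rpow c θ hp0.le
  have iQ := integrable_norm_heatSum_I_rpow c θ κ (r := p / 2) (q := q) (by positivity)
    hq0.le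
  have hcont : Continuous (lineFourier (dampedSum c θ p)) := by
    have h : Continuous fun s : ℝ => heatSum c θ (Complex.I * κ * (-p / κ * s : ℝ)) (p / 2) :=
      continuous_heatSum c θ (by fun_prop) _
    rw [funext (lineFourier_dampedSum c θ hp0 hκ0.ne')]
    fun_prop
  have hmem1 : MemLp (dampedSum c θ p) (ENNReal.ofReal p) volume := by
    rw [← integrable_norm_rpow_iff (continuous_dampedSum c θ p).aestronglyMeasurable hp'
      ENNReal.ofReal_ne_top, ENNReal.toReal_ofReal hp0.le]
    simp only [norm_dampedSum_rpow c θ hp0]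
    exact integrable_gauss_iff_exp.1 iP
  have ha : -p / κ ≠ 0 := div_ne_zero (neg_ne_zero.2 hp0.ne') hκ0.ne'
  have hmem2 : MemLp (lineFourier (dampedSum c θ p)) (ENNReal.ofReal q) volume := by
    rw [← integrable_norm_rpow_iff hcont.aestronglyMeasurable hq'
      ENNReal.ofReal_ne_top, ENNReal.toReal_ofReal hq0.le]
    simp only [norm_lineFourier_dampedSum_rpow c θ hp1 hκ hpq]
    exact ((integrable_gauss_iff_exp.1 iQ).comp_mul_left' ha).const_mul _
  rw [hmem1.eLpNorm_eq_integral_rpow_norm hp' ENNReal.ofReal_ne_top,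
    hmem2.eLpNorm_eq_integral_rpow_norm hq' ENNReal.ofReal_ne_top,
    ENNReal.toReal_ofReal hp0.le, ENNReal.toReal_ofReal hq0.le,
    ← ENNReal.ofReal_mul (hausdorffYoungConst_pos hp1).le]
  refine ENNReal.ofReal_le_ofReal ?_
  simp only [norm_lineFourier_dampedSum_rpow c θ hp1 hκ hpq, norm_dampedSum_rpow c θ hp0]
  have h2 := integral_norm_heatSum_rpow_le c θ hp1 hp2 hκ hpq
  have eA := integral_gauss_eq fun η => ‖heatSum c θ (Complex.I * κ * η) (p / 2)‖ ^ q
  have eB := integral_gauss_eq fun x => ‖heatSum c θ x 0‖ ^ p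
  set A := ∫ η : ℝ, ‖heatSum c θ (Complex.I * κ * η) (p / 2)‖ ^ q ∂gauss
  set B := ∫ x : ℝ, ‖heatSum c θ x 0‖ ^ p ∂gauss
  have hA0 : 0 ≤ A := integral_nonneg fun η => by positivity
  have hB0 : 0 ≤ B := integral_nonneg fun η => by positivity
  have hπ : 0 < √(2 * Real.pi) := by positivity
  rw [integral_const_mul, Measure.integral_comp_mul_left (fun y => Real.exp (-y ^ 2 / 2) *
    ‖heatSum c θ (Complex.I * κ * y) (p / 2)‖ ^ q) (-p / κ)]
  rw [eq_comm, inv_mul_eq_iff_eq_mul₀ hπ.ne'] at eA eB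
  have habs : |(-p / κ)⁻¹| = κ / p := by
    rw [abs_inv, abs_div, abs_neg, abs_of_pos hp0, abs_of_pos hκ0, inv_div]
  rw [eA, eB, habs, smul_eq_mul, Real.mul_rpow hπ.le hB0, inv_eq_one_div, inv_eq_one_div,
    ← mul_assoc (hausdorffYoungConst p), ← hausdorffYoungConst_identity hp1 hκ0 hκ hpq,
    ← mul_assoc (κ / p), ← mul_assoc (_ ^ (q / 2)), Real.mul_rpow (by positivity) hA0]
  refine mul_le_mul_of_nonneg_left ?_ (by positivity)
  have h3 := Real.rpow_le_rpow (by positivity) h2 (by positivity : 0 ≤ 1 / p)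
  rwa [← Real.rpow_mul hA0, show p / q * (1 / p) = 1 / q by field_simp] at h3

end Transfer

/-- The sharp Hausdorff-Young bound for a function on the line. -/
def HausdorffYoungBound (p q : ℝ) (g : ℝ → ℂ) : Prop :=
  eLpNorm (lineFourier g) (ENNReal.ofReal q) volume
    ≤ ENNReal.ofReal (hausdorffYoungConst p) * eLpNorm g (ENNReal.ofReal p) volume

/-! ### From damped exponential sums to bounded functions on [−1, 1] -/

lemma norm_cexp_neg_I_mul (s x : ℝ) : ‖Complex.exp (-Complex.I * s * x)‖ = 1 := by
  rw [show -Complex.I * s * x = ((-(s * x) : ℝ) : ℂ) * Complex.I by push_cast; ring,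
    Complex.norm_exp_ofReal_mul_I]

lemma continuous_lineFourier {g : ℝ → ℂ} (hg : Integrable g) : Continuous (lineFourier g) := by
  refine continuous_of_dominated (bound := fun x => ‖g x‖) (fun s => ?_)
    (fun s => Eventually.of_forall fun x => ?_) hg.norm
    (Eventually.of_forall fun x => by fun_prop)
  · exact (Continuous.aestronglyMeasurable (by fun_prop)).mul hg.aestronglyMeasurable
  · rw [norm_mul, norm_cexp_neg_I_mul, one_mul]

/-- The bound is stable under dominated convergence. -/
lemma HausdorffYoungBound.of_tendsto {p q : ℝ} (hp : 0 < p) {g : ℕ → ℝ → ℂ} {g' : ℝ → ℂ}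
    {B : ℝ → ℝ} (hB : Integrable B) (hBp : MemLp B (ENNReal.ofReal p) volume)
    (hg : ∀ n, AEStronglyMeasurable (g n) volume) (hgB : ∀ n x, ‖g n x‖ ≤ B x)
    (hlim : ∀ᵐ x : ℝ, Tendsto (fun n => g n x) atTop (𝓝 (g' x)))
    (h : ∀ n, HausdorffYoungBound p q (g n)) : HausdorffYoungBound p q g' := by
  have hp0 : ENNReal.ofReal p ≠ 0 := by simpa using hp
  have hint (n : ℕ) : Integrable (g n) := hB.mono' (hg n) (Eventually.of_forall (hgB n))
  have h1 : Tendsto (fun n => eLpNorm (g n) (ENNReal.ofReal p) volume) atTop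
      (𝓝 (eLpNorm g' (ENNReal.ofReal p) volume)) := by
    simp only [eLpNorm_eq_lintegral_rpow_enorm_toReal hp0 ENNReal.ofReal_ne_top,
      ENNReal.toReal_ofReal hp.le]
    refine (ENNReal.continuous_rpow_const.tendsto _).comp
      (tendsto_lintegral_of_dominated_convergence' (fun x => ‖B x‖ₑ ^ p)
        (fun n => (hg n).enorm.pow_const p) (fun n => Eventually.of_forall fun x => ?_) ?_ ?_)
    · refine ENNReal.rpow_le_rpow ?_ hp.le
      exact enorm_le_iff_norm_le.2 ((hgB n x).trans (le_abs_self _))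
    · have := lintegral_rpow_enorm_lt_top_of_eLpNorm_lt_top hp0 ENNReal.ofReal_ne_top hBp.2
      rw [ENNReal.toReal_ofReal hp.le] at this
      exact this.ne
    · filter_upwards [hlim] with x hx
      exact (ENNReal.continuous_rpow_const.tendsto _).comp hx.enorm
  have h2 (s : ℝ) : Tendsto (fun n => lineFourier (g n) s) atTop (𝓝 (lineFourier g' s)) := by
    refine tendsto_integral_of_dominated_convergence B (fun n => ?_) hB
      (fun n => Eventually.of_forall fun x => ?_) ?_
    · exact (Continuous.aestronglyMeasurable (by fun_prop)).mul (hg n)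
    · rw [norm_mul, norm_cexp_neg_I_mul, one_mul]
      exact hgB n x
    · filter_upwards [hlim] with x hx
      exact hx.const_mul _
  -- Fatou on the transform side: pointwise convergence suffices there, while the p-norms of the
  -- functions converge by domination.
  refine (Lp.eLpNorm_lim_le_liminf_eLpNorm
    (fun n => (continuous_lineFourier (hint n)).aestronglyMeasurable) _
    (Eventually.of_forall h2)).trans ?_
  have h3 := ENNReal.Tendsto.const_mul (a := ENNReal.ofReal (hausdorffYoungConst p)) h1
    (Or.inr ENNReal.ofReal_ne_top)
  rw [← h3.liminf_eq]
  exact liminf_le_liminf (Eventually.of_forall h)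

/-- Trigonometric approximation of a continuous function supported in `[-2, 2]`. -/
lemma exists_heatSum_approx {φ : ℝ → ℂ} (hφ : Continuous φ) (h0 : ∀ x, 2 < |x| → φ x = 0)
    {M T δ : ℝ} (hM : ∀ x, ‖φ x‖ ≤ M) (hT : 4 < T) (hδ : 0 < δ) :
    ∃ (ι : Type) (_ : Fintype ι) (c : ι → ℂ) (θ : ι → ℝ),
      (∀ x : ℝ, ‖heatSum c θ x 0‖ ≤ M + δ) ∧
      ∀ x : ℝ, |x| < T / 2 → ‖heatSum c θ x 0 - φ x‖ ≤ δ := by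
  have : Fact (0 < T) := ⟨by linarith⟩
  -- As T > 4, φ vanishes at ±T/2 and descends to a continuous function on the circle, where
  -- trigonometric polynomials are uniformly dense. Periodicity then gives the bound M + δ on the
  -- whole line, not just on one period.
  have hper : φ (-(T / 2)) = φ (-(T / 2) + T) := by
    rw [h0 _ (by rw [abs_neg, abs_of_pos] <;> linarith),
      h0 _ (by rw [abs_of_pos] <;> linarith)]
  let Φ : C(AddCircle T, ℂ) := ⟨AddCircle.liftIco T (-(T / 2)) φ,
    AddCircle.liftIco_continuous hper hφ.continuousOn⟩
  have hΦ : ∀ x ∈ Set.Ico (-(T / 2)) (-(T / 2) + T), Φ (x : AddCircle T) = φ x :=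
    fun x hx => AddCircle.liftIco_coe_apply hx
  have hΦM : ∀ y, ‖Φ y‖ ≤ M := fun y => by
    have hy : y ∈ (QuotientAddGroup.mk '' Set.Ico (-(T / 2)) (-(T / 2) + T) : Set (AddCircle T)) := by
      rw [AddCircle.coe_image_Ico_eq]
      trivial
    obtain ⟨x, hx, rfl⟩ := hy
    exact (congrArg norm (hΦ x hx)).trans_le (hM x)
  have hmem : Φ ∈ (Submodule.span ℂ (Set.range (@fourier T))).topologicalClosure := by
    rw [span_fourier_closure_eq_top]
    trivial
  obtain ⟨P, hP, hPΦ⟩ := Metric.mem_closure_iff.1 hmem δ hδ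
  obtain ⟨a, rfl⟩ := Finsupp.mem_span_range_iff_exists_finsupp.1 hP
  have hval : ∀ x : ℝ, heatSum (fun j : a.support => a j)
      (fun j : a.support => 2 * Real.pi * (j : ℤ) / T) x 0
      = (a.sum fun i r => r • (@fourier T i)) (x : AddCircle T) := fun x => by
    rw [Finsupp.sum, ContinuousMap.sum_apply, heatSum,
      Finset.sum_coe_sort a.support (fun i : ℤ => a i * Complex.exp (Complex.I *
        ((2 * Real.pi * i / T : ℝ) : ℂ) * x - ((2 * Real.pi * i / T : ℝ) : ℂ) ^ 2 * (0 : ℝ)))]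
    refine Finset.sum_congr rfl fun i _ => ?_
    rw [ContinuousMap.smul_apply, fourier_coe_apply, smul_eq_mul]
    congr 2
    push_cast
    ring
  have hdist : ∀ y, ‖(a.sum fun i r => r • (@fourier T i)) y - Φ y‖ ≤ δ := fun y => by
    rw [← dist_eq_norm, dist_comm]
    exact (ContinuousMap.dist_apply_le_dist y).trans hPΦ.le
  refine ⟨a.support, inferInstance, fun j => a j, fun j => 2 * Real.pi * (j : ℤ) / T, fun x => ?_, fun x hx => ?_⟩
  · rw [hval]
    have := norm_sub_norm_le ((a.sum fun i r => r • (@fourier T i)) (x : AddCircle T)) (Φ x)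
    linarith [hdist x, hΦM x]
  · rw [hval, ← hΦ x ⟨by linarith [neg_abs_le x], by linarith [le_abs_self x]⟩]
    exact hdist x

lemma integrable_exp_neg_sq_div {p : ℝ} (hp : 0 < p) :
    Integrable fun x : ℝ => Real.exp (-x ^ 2 / p) := by
  refine (integrable_exp_neg_mul_sq (b := 1 / p) (by positivity)).congr
    (Eventually.of_forall fun x => ?_)
  simp only
  congr 1
  ring

lemma memLp_const_mul_exp_neg_sq {p : ℝ} (hp : 0 < p) (C : ℝ) :
    MemLp (fun x : ℝ => C * Real.exp (-x ^ 2 / (2 * p))) (ENNReal.ofReal p) volume := by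
  refine MemLp.const_mul ?_ C
  rw [← integrable_norm_rpow_iff (Continuous.aestronglyMeasurable (by fun_prop)) (by simpa using hp)
      ENNReal.ofReal_ne_top, ENNReal.toReal_ofReal hp.le]
  refine (integrable_exp_neg_sq_div (p := 2) two_pos).congr (Eventually.of_forall fun x => ?_)
  simp only
  rw [Real.norm_of_nonneg (Real.exp_pos _).le, ← Real.exp_mul]
  congr 1
  field_simp

/-- The damping is divided out first: g·exp(x²/2p) is still continuous with support in [−2, 2], so
it is approximated by exponential sums and the Gaussian is restored. The periodic copies do no harm,
being bounded and damped by that Gaussian. -/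
lemma hausdorffYoungBound_of_continuous {p q : ℝ} (hp1 : 1 < p) (hp2 : p ≤ 2)
    (hpq : (p - 1) * (q - 1) = 1) {g : ℝ → ℂ} (hg : Continuous g)
    (h0 : ∀ x, 2 < |x| → g x = 0) : HausdorffYoungBound p q g := by
  have hp0 : 0 < p := by linarith
  set φ : ℝ → ℂ := fun x => g x * (Real.exp (x ^ 2 / (2 * p)) : ℝ) with hφdef
  have hφ : Continuous φ := by fun_prop
  have hφ0 : ∀ x, 2 < |x| → φ x = 0 := fun x hx => by simp [hφdef, h0 x hx]
  obtain ⟨M, hM⟩ : ∃ M, ∀ x, ‖φ x‖ ≤ M := by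
    refine hφ.bounded_above_of_compact_support (HasCompactSupport.of_support_subset_isCompact
      (isCompact_Icc (a := (-2 : ℝ)) (b := 2)) fun x hx => ?_)
    have : |x| ≤ 2 := not_lt.1 fun h => hx (hφ0 x h)
    exact abs_le.1 this
  -- The period n + 5 exceeds 4 for every n and tends to infinity, so each fixed x eventually lies
  -- in the central period.
  choose ι hι c θ hle hclose using fun n : ℕ =>
    exists_heatSum_approx hφ hφ0 hM (T := n + 5) (δ := 1 / ((n : ℝ) + 1))
      (by linarith [Nat.cast_nonneg (α := ℝ) n]) Nat.one_div_pos_of_nat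
  refine HausdorffYoungBound.of_tendsto (q := q) hp0
    (g := fun n => @dampedSum (ι n) (hι n) (c n) (θ n) p)
    (B := fun x => (M + 1) * Real.exp (-x ^ 2 / (2 * p)))
    ((integrable_exp_neg_sq_div (by positivity)).const_mul _) (memLp_const_mul_exp_neg_sq hp0 _)
    (fun n => (@continuous_dampedSum (ι n) (hι n) (c n) (θ n) p).aestronglyMeasurable)
    (fun n x => ?_) (Eventually.of_forall fun x => ?_)
    (fun n => @eLpNorm_lineFourier_dampedSum_le (ι n) (hι n) (c n) (θ n) p q hp1 hp2 hpq)
  · rw [dampedSum, norm_mul, Complex.norm_real, Real.norm_of_nonneg (Real.exp_pos _).le]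
    refine mul_le_mul_of_nonneg_right ((hle n x).trans ?_) (Real.exp_pos _).le
    have : 1 / ((n : ℝ) + 1) ≤ 1 := by
      rw [div_le_one (by positivity)]
      linarith [Nat.cast_nonneg (α := ℝ) n]
    linarith
  · have hgx : g x = φ x * (Real.exp (-x ^ 2 / (2 * p)) : ℝ) := by
      rw [hφdef, mul_assoc, ← Complex.ofReal_mul, ← Real.exp_add, neg_div, add_neg_cancel,
        Real.exp_zero, Complex.ofReal_one, mul_one]
    rw [hgx]
    refine Tendsto.mul_const _ ?_
    rw [tendsto_iff_norm_sub_tendsto_zero]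
    refine squeeze_zero' (Eventually.of_forall fun n => norm_nonneg _) ?_
      tendsto_one_div_add_atTop_nhds_zero_nat
    filter_upwards [eventually_ge_atTop ⌈2 * |x|⌉₊] with n hn
    refine hclose n x ?_
    have := (Nat.le_ceil (2 * |x|)).trans (Nat.cast_le.2 hn)
    linarith

lemma hausdorffYoungBound_of_bounded {p q : ℝ} (hp1 : 1 < p) (hp2 : p ≤ 2)
    (hpq : (p - 1) * (q - 1) = 1) {F : ℝ → ℂ} (hF : AEStronglyMeasurable F volume) {M : ℝ}
    (hM : ∀ x, ‖F x‖ ≤ M) (h0 : ∀ x, 1 < |x| → F x = 0) : HausdorffYoungBound p q F := by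
  have hM0 : 0 ≤ M := (norm_nonneg _).trans (hM 0)
  let φ : ℕ → ContDiffBump (0 : ℝ) := fun n =>
    ⟨1 / ((n : ℝ) + 2) / 2, 1 / ((n : ℝ) + 2), by positivity, half_lt_self (by positivity)⟩
  have hφlim : Tendsto (fun n => (φ n).rOut) atTop (𝓝 0) := by
    have := (tendsto_one_div_add_atTop_nhds_zero_nat (𝕜 := ℝ)).comp (tendsto_add_atTop_nat 1)
    refine this.congr fun n => ?_
    simp only [φ, Function.comp_apply]
    push_cast
    ring
  have hφle : ∀ n, (φ n).rOut ≤ 1 := fun n => by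
    simp only [φ]
    rw [div_le_one (by positivity)]
    linarith [Nat.cast_nonneg (α := ℝ) n]
  have hFi : Integrable F := by
    have : Integrable (fun x => (Set.Icc (-1 : ℝ) 1).indicator (fun _ => M) x) :=
      (integrable_indicator_iff measurableSet_Icc).2 (integrableOn_const (by simp))
    refine this.mono' hF (Eventually.of_forall fun x => ?_)
    by_cases hx : x ∈ Set.Icc (-1 : ℝ) 1
    · rw [Set.indicator_of_mem hx]
      exact hM x
    · rw [Set.indicator_of_notMem hx, h0 x (not_le.1 fun h => hx (abs_le.1 h)), norm_zero]
  let g : ℕ → ℝ → ℂ := fun n =>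
    convolution ((φ n).normed volume) F (ContinuousLinearMap.lsmul ℝ ℝ) volume
  -- A mollifier average stays within the distance e of 0 that F keeps on the ball. Taking e = M
  -- gives the uniform bound, and e = 0 the support in [−2, 2].
  have hdist : ∀ n x {e : ℝ}, 0 ≤ e → (∀ y ∈ Metric.ball x (φ n).rOut, dist (F y) 0 ≤ e) →
      dist (g n x) 0 ≤ e := fun n x e he h =>
    dist_convolution_le he (φ n).support_normed_eq.subset (fun y => (φ n).nonneg_normed y)
      (φ n).integral_normed hF h
  have hgM : ∀ n x, ‖g n x‖ ≤ M := fun n x => by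
    rw [← dist_zero_right]
    exact hdist n x hM0 fun y _ => by rw [dist_zero_right]; exact hM y
  have hg0 : ∀ n x, 2 < |x| → g n x = 0 := fun n x hx => by
    rw [← dist_le_zero]
    refine hdist n x le_rfl fun y hy => ?_
    rw [h0 y, dist_self]
    rw [Metric.mem_ball, Real.dist_eq, abs_sub_comm] at hy
    have := abs_sub_abs_le_abs_sub x y
    linarith [hφle n]
  have hgc : ∀ n, Continuous (g n) := fun n =>
    HasCompactSupport.continuous_convolution_left _ (φ n).hasCompactSupport_normed
      (φ n).continuous_normed hFi.locallyIntegrable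
  -- Almost everywhere convergence is Lebesgue differentiation for shrinking bumps; it needs the
  -- outer radius to be at most a fixed multiple of the inner one, here 2.
  refine HausdorffYoungBound.of_tendsto (q := q) (by linarith) (g := g)
    (B := (Set.Icc (-2 : ℝ) 2).indicator fun _ => M)
    ((integrable_indicator_iff measurableSet_Icc).2 (integrableOn_const (by simp)))
    (memLp_indicator_const _ measurableSet_Icc _ (Or.inr (by simp)))
    (fun n => (hgc n).aestronglyMeasurable) (fun n x => ?_)
    (ContDiffBump.ae_convolution_tendsto_right_of_locallyIntegrable (K := 2) hφlim
      (Eventually.of_forall fun n => ?_) hFi.locallyIntegrable)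
    (fun n => hausdorffYoungBound_of_continuous hp1 hp2 hpq (hgc n) (hg0 n))
  · by_cases hx : x ∈ Set.Icc (-2 : ℝ) 2
    · rw [Set.indicator_of_mem hx]
      exact hgM n x
    · rw [Set.indicator_of_notMem hx, hg0 n x (not_le.1 fun h => hx (abs_le.1 h)), norm_zero]
  · simp only [φ]
    linarith

/-! ### Functions on `[-1, 1]` -/

lemma fhat_eq_setIntegral (f : ℝ → ℂ) (z : ℂ) :
    fhat f z = ∫ t, Complex.exp (-Complex.I * z * t) * f t ∂intervalMeasure := by
  rw [fhat, intervalIntegral.integral_of_le (by norm_num), integral_Icc_eq_integral_Ioc]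

lemma ae_norm_le_of_memLp_top {f : ℝ → ℂ} (hf : MemLp f ∞ intervalMeasure) :
    ∀ᵐ x, x ∈ Set.Icc (-1 : ℝ) 1 → ‖f x‖ ≤ (eLpNorm f ∞ intervalMeasure).toReal := by
  refine (ae_restrict_iff' measurableSet_Icc).1 ?_
  filter_upwards [ae_le_eLpNormEssSup (f := f) (μ := intervalMeasure)] with x hx
  rw [← toReal_enorm]
  refine ENNReal.toReal_mono hf.2.ne ?_
  rwa [eLpNorm_exponent_top]

/-- An essentially bounded function on `[-1, 1]` has a bounded representative on the line that
vanishes off `[-1, 1]`. -/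
lemma exists_bounded_representative {f : ℝ → ℂ} (hf : MemLp f ∞ intervalMeasure) :
    ∃ F : ℝ → ℂ, AEStronglyMeasurable F volume ∧
      (∀ x, ‖F x‖ ≤ (eLpNorm f ∞ intervalMeasure).toReal) ∧ (∀ x, 1 < |x| → F x = 0) ∧
      F =ᵐ[volume] (Set.Icc (-1 : ℝ) 1).indicator f := by
  set M := (eLpNorm f ∞ intervalMeasure).toReal
  set f' := hf.1.mk f
  have hf' : StronglyMeasurable f' := hf.1.stronglyMeasurable_mk
  have hS : MeasurableSet {x | x ∈ Set.Icc (-1 : ℝ) 1 ∧ ‖f' x‖ ≤ M} :=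
    measurableSet_Icc.inter (measurableSet_le hf'.norm.measurable measurable_const)
  refine ⟨{x | x ∈ Set.Icc (-1 : ℝ) 1 ∧ ‖f' x‖ ≤ M}.indicator f',
    (hf'.indicator hS).aestronglyMeasurable, fun x => ?_, fun x hx => ?_, ?_⟩
  · by_cases hx : x ∈ {x | x ∈ Set.Icc (-1 : ℝ) 1 ∧ ‖f' x‖ ≤ M}
    · rw [Set.indicator_of_mem hx]
      exact hx.2
    · rw [Set.indicator_of_notMem hx, norm_zero]
      exact ENNReal.toReal_nonneg
  · exact Set.indicator_of_notMem (fun h => hx.not_ge (abs_le.2 h.1)) _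
  · have h1 : ∀ᵐ x, x ∈ Set.Icc (-1 : ℝ) 1 → f x = f' x :=
      (ae_restrict_iff' measurableSet_Icc).1 hf.1.ae_eq_mk
    have h2 := ae_norm_le_of_memLp_top hf
    filter_upwards [h1, h2] with x hx1 hx2
    by_cases hx : x ∈ Set.Icc (-1 : ℝ) 1
    · have hx3 : x ∈ {x | x ∈ Set.Icc (-1 : ℝ) 1 ∧ ‖f' x‖ ≤ M} := ⟨hx, hx1 hx ▸ hx2 hx⟩
      rw [Set.indicator_of_mem hx, Set.indicator_of_mem hx3, hx1 hx]
    · rw [Set.indicator_of_notMem hx, Set.indicator_of_notMem fun h => hx h.1]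

lemma eLpNorm_fhat_le {f : ℝ → ℂ} (hf : MemLp f ∞ intervalMeasure) {p q : ℝ} (hp1 : 1 < p)
    (hp2 : p ≤ 2) (hpq : (p - 1) * (q - 1) = 1) :
    eLpNorm (fun s : ℝ => fhat f (s : ℂ)) (ENNReal.ofReal q) volume
      ≤ ENNReal.ofReal (hausdorffYoungConst p)
        * eLpNorm f (ENNReal.ofReal p) intervalMeasure := by
  obtain ⟨F, hFm, hFM, hF0, hFf⟩ := exists_bounded_representative hf
  have h := hausdorffYoungBound_of_bounded hp1 hp2 hpq hFm hFM hF0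
  have e : lineFourier F = fun s : ℝ => fhat f (s : ℂ) := by
    funext s
    rw [fhat_eq_setIntegral, ← integral_indicator measurableSet_Icc, lineFourier]
    refine integral_congr_ae ?_
    filter_upwards [hFf] with x hx
    rw [hx]
    by_cases hx : x ∈ Set.Icc (-1 : ℝ) 1
    · rw [Set.indicator_of_mem hx, Set.indicator_of_mem hx]
    · rw [Set.indicator_of_notMem hx, Set.indicator_of_notMem hx, mul_zero]
  rwa [HausdorffYoungBound, e, eLpNorm_congr_ae hFf,
    eLpNorm_indicator_eq_eLpNorm_restrict measurableSet_Icc] at h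

/-! ### Entire functions defined by integrals over `[-1, 1]` -/

/-- The derivative of `v` in its first variable. -/
def v' (z : ℂ) (t : ℝ) : ℂ :=
  if t = 0 then z else -Complex.I * (1 - Complex.exp (-Complex.I * z * t)) / t

lemma hasDerivAt_cexp_neg_I_mul (z : ℂ) (t : ℝ) :
    HasDerivAt (fun w : ℂ => Complex.exp (-Complex.I * w * t))
      (-Complex.I * t * Complex.exp (-Complex.I * z * t)) z := by
  refine (((hasDerivAt_id z).const_mul (-Complex.I)).mul_const (t : ℂ)).cexp.congr_deriv ?_
  simp only [id]
  ring

lemma hasDerivAt_v (z : ℂ) (t : ℝ) : HasDerivAt (fun w => v w t) (v' z t) z := by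
  by_cases ht : t = 0
  · simp only [v, v', ht, if_true]
    refine (((hasDerivAt_id z).pow 2).div_const 2).congr_deriv ?_
    simp
  · simp only [v, v', ht, if_false]
    have ht' : (t : ℂ) ≠ 0 := by exact_mod_cast ht
    refine (((((hasDerivAt_id z).const_mul Complex.I).mul_const (t : ℂ)).const_sub 1).sub
      (hasDerivAt_cexp_neg_I_mul z t) |>.div_const ((t : ℂ) ^ 2)).congr_deriv ?_
    field_simp
    ring

lemma hasDerivAt_v' (z : ℂ) (t : ℝ) :
    HasDerivAt (fun w => v' w t) (Complex.exp (-Complex.I * z * t)) z := by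
  by_cases ht : t = 0
  · simp only [v', ht, if_true]
    exact (hasDerivAt_id z).congr_deriv (by simp)
  · simp only [v', ht, if_false]
    have ht' : (t : ℂ) ≠ 0 := by exact_mod_cast ht
    refine (((hasDerivAt_cexp_neg_I_mul z t).const_sub 1).const_mul (-Complex.I)
      |>.div_const (t : ℂ)).congr_deriv ?_
    field_simp
    linear_combination -Complex.I_sq

lemma measurable_v (z : ℂ) : Measurable (v z) :=
  Measurable.ite (measurableSet_singleton 0) measurable_const (by fun_prop)

lemma measurable_v' (z : ℂ) : Measurable (v' z) :=
  Measurable.ite (measurableSet_singleton 0) measurable_const (by fun_prop)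

lemma norm_neg_I_mul_mul (z : ℂ) (t : ℝ) : ‖-Complex.I * z * t‖ = ‖z‖ * |t| := by
  simp

lemma norm_cexp_neg_I_mul_le (z : ℂ) {t : ℝ} (ht : |t| ≤ 1) :
    ‖Complex.exp (-Complex.I * z * t)‖ ≤ Real.exp ‖z‖ := by
  refine (Complex.norm_exp_le_exp_norm _).trans (Real.exp_le_exp.2 ?_)
  rw [norm_neg_I_mul_mul]
  exact mul_le_of_le_one_right (norm_nonneg z) ht

/-- The numerator of v is minus the second-order Taylor remainder of the exponential at −izt, whose
factor |t|² cancels the denominator. -/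
lemma norm_v_le (z : ℂ) {t : ℝ} (ht : |t| ≤ 1) : ‖v z t‖ ≤ ‖z‖ ^ 2 * Real.exp ‖z‖ := by
  by_cases h0 : t = 0
  · simp only [v, h0, if_true, norm_div, norm_pow, RCLike.norm_ofNat]
    have := Real.one_le_exp (norm_nonneg z)
    nlinarith [sq_nonneg ‖z‖]
  · simp only [v, h0, if_false]
    have h := Complex.norm_exp_sub_sum_le_norm_mul_exp (-Complex.I * z * t) 2
    have e : 1 - Complex.I * z * t - Complex.exp (-Complex.I * z * t)
        = -(Complex.exp (-Complex.I * z * t) -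
          ∑ m ∈ Finset.range 2, (-Complex.I * z * t) ^ m / (m.factorial : ℂ)) := by
      simp [Finset.sum_range_succ]
      ring
    rw [e, norm_div, norm_neg, norm_pow, Complex.norm_real, Real.norm_eq_abs, div_le_iff₀
      (by positivity)]
    refine h.trans ?_
    rw [norm_neg_I_mul_mul, mul_pow, mul_right_comm]
    gcongr
    exact mul_le_of_le_one_right (norm_nonneg z) ht

lemma norm_v'_le (z : ℂ) {t : ℝ} (ht : |t| ≤ 1) : ‖v' z t‖ ≤ ‖z‖ * Real.exp ‖z‖ := by
  by_cases h0 : t = 0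
  · simp only [v', h0, if_true]
    exact le_mul_of_one_le_right (norm_nonneg z) (Real.one_le_exp (norm_nonneg z))
  · simp only [v', h0, if_false]
    have h := Complex.norm_exp_sub_sum_le_norm_mul_exp (-Complex.I * z * t) 1
    simp only [Finset.range_one, Finset.sum_singleton, pow_zero, Nat.factorial_zero, Nat.cast_one,
      div_one, pow_one] at h
    rw [norm_div, norm_mul, norm_neg, Complex.norm_I, one_mul, norm_sub_rev, Complex.norm_real,
      Real.norm_eq_abs, div_le_iff₀ (by positivity)]
    refine h.trans ?_
    rw [norm_neg_I_mul_mul, mul_right_comm]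
    gcongr
    exact mul_le_of_le_one_right (norm_nonneg z) ht

lemma ae_abs_le_one : ∀ᵐ t ∂intervalMeasure, |t| ≤ 1 := by
  filter_upwards [ae_restrict_mem measurableSet_Icc] with t ht
  exact abs_le.2 ht

lemma integrable_kernel_mul {f : ℝ → ℂ} (hf : Integrable f intervalMeasure) {k : ℝ → ℂ}
    (hk : Measurable k) {C : ℝ} (hC : ∀ t, |t| ≤ 1 → ‖k t‖ ≤ C) :
    Integrable (fun t => k t * f t) intervalMeasure :=
  hf.bdd_mul hk.aestronglyMeasurable (ae_abs_le_one.mono hC)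

/-- Differentiation under the integral over the unit ball at z: since b' is monotone, its value at
‖z‖ + 1 dominates k' there. -/
lemma hasDerivAt_integral_kernel {f : ℝ → ℂ} (hf : Integrable f intervalMeasure) {k k' : ℂ → ℝ → ℂ}
    (hk : ∀ z, Measurable (k z)) (hk' : ∀ z, Measurable (k' z)) {b b' : ℝ → ℝ} (hb' : MonotoneOn b' (Set.Ici 0))
    (hkb : ∀ z t, |t| ≤ 1 → ‖k z t‖ ≤ b ‖z‖) (hkb' : ∀ z t, |t| ≤ 1 → ‖k' z t‖ ≤ b' ‖z‖)
    (hder : ∀ z t, HasDerivAt (fun w => k w t) (k' z t) z) (z : ℂ) :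
    HasDerivAt (fun w => ∫ t, k w t * f t ∂intervalMeasure)
      (∫ t, k' z t * f t ∂intervalMeasure) z := by
  refine (hasDerivAt_integral_of_dominated_loc_of_deriv_le (s := Metric.ball z 1)
    (F := fun w t => k w t * f t) (F' := fun w t => k' w t * f t)
    (bound := fun t => b' (‖z‖ + 1) * ‖f t‖) (Metric.ball_mem_nhds z one_pos)
    (Eventually.of_forall fun w => (integrable_kernel_mul hf (hk w) (hkb w)).aestronglyMeasurable)
    (integrable_kernel_mul hf (hk z) (hkb z))
    (integrable_kernel_mul hf (hk' z) (hkb' z)).aestronglyMeasurable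
    (ae_abs_le_one.mono fun t ht w hw => ?_) (hf.norm.const_mul _)
    (Eventually.of_forall fun t w _ => (hder w t).mul_const (f t))).2
  rw [norm_mul]
  refine mul_le_mul_of_nonneg_right ((hkb' w t ht).trans (hb' (norm_nonneg w)
    (add_nonneg (norm_nonneg z) zero_le_one) ?_)) (norm_nonneg _)
  have h1 := norm_sub_norm_le w z
  rw [Metric.mem_ball, dist_eq_norm] at hw
  linarith

lemma intervalIntegral_eq_integral (g : ℝ → ℂ) :
    ∫ t in (-1 : ℝ)..1, g t = ∫ t, g t ∂intervalMeasure := by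
  rw [intervalIntegral.integral_of_le (by norm_num), integral_Icc_eq_integral_Ioc]

/-- The entire extension of `Omega f`. -/
def omegaExt (f : ℝ → ℂ) (z : ℂ) : ℂ := ∫ t, v z t * f t ∂intervalMeasure

/-- The derivative of the entire extension of `Omega f`. -/
def omegaExt' (f : ℝ → ℂ) (z : ℂ) : ℂ := ∫ t, v' z t * f t ∂intervalMeasure

lemma differentiable_fhat {f : ℝ → ℂ} (hf : Integrable f intervalMeasure) :
    Differentiable ℂ (fhat f) := fun z => by
  rw [funext (fhat_eq_setIntegral f)]
  refine (hasDerivAt_integral_kernel hf (k := fun z t => Complex.exp (-Complex.I * z * t))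
    (k' := fun z t => -Complex.I * t * Complex.exp (-Complex.I * z * t)) (b := Real.exp)
    (b' := Real.exp) (fun z => by fun_prop) (fun z => by fun_prop) (Real.exp_monotone.monotoneOn _)
    (fun z t ht => norm_cexp_neg_I_mul_le z ht) (fun z t ht => ?_)
    hasDerivAt_cexp_neg_I_mul z).differentiableAt
  rw [norm_mul, norm_mul, norm_neg, Complex.norm_I, one_mul, Complex.norm_real]
  exact (mul_le_of_le_one_left (norm_nonneg _) ht).trans (norm_cexp_neg_I_mul_le z ht)

lemma hasDerivAt_omegaExt {f : ℝ → ℂ} (hf : Integrable f intervalMeasure) (z : ℂ) :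
    HasDerivAt (omegaExt f) (omegaExt' f z) z := by
  refine hasDerivAt_integral_kernel hf (b := fun r => r ^ 2 * Real.exp r)
    (b' := fun r => r * Real.exp r) measurable_v measurable_v' (fun x hx y hy hxy => ?_)
    (fun z t ht => norm_v_le z ht) (fun z t ht => norm_v'_le z ht) hasDerivAt_v z
  have hx' : (0 : ℝ) ≤ x := hx
  simp only
  gcongr

lemma hasDerivAt_omegaExt' {f : ℝ → ℂ} (hf : Integrable f intervalMeasure) (z : ℂ) :
    HasDerivAt (omegaExt' f) (fhat f z) z := by
  rw [fhat_eq_setIntegral]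
  exact hasDerivAt_integral_kernel hf (k' := fun z t => Complex.exp (-Complex.I * z * t))
    (b := fun r => r * Real.exp r) (b' := Real.exp) measurable_v' (fun z => by fun_prop)
    (Real.exp_monotone.monotoneOn _) (fun z t ht => norm_v'_le z ht)
    (fun z t ht => norm_cexp_neg_I_mul_le z ht) hasDerivAt_v' z

lemma omegaExt_zero (f : ℝ → ℂ) : omegaExt f 0 = 0 := by
  simp [omegaExt, v]

lemma omegaExt'_zero (f : ℝ → ℂ) : omegaExt' f 0 = 0 := by
  simp [omegaExt', v']

lemma continuous_fhat_ofReal {f : ℝ → ℂ} (hf : Integrable f intervalMeasure) :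
    Continuous fun s : ℝ => fhat f s :=
  (differentiable_fhat hf).continuous.comp Complex.continuous_ofReal

lemma continuous_omegaExt'_ofReal {f : ℝ → ℂ} (hf : Integrable f intervalMeasure) :
    Continuous fun s : ℝ => omegaExt' f s :=
  continuous_iff_continuousAt.2 fun s => (hasDerivAt_omegaExt' hf s).comp_ofReal.continuousAt

/-- The fundamental theorem of calculus applied twice; no constants appear because v and v' vanish
at z = 0. -/
lemma Omega_eq_omegaExt {f : ℝ → ℂ} (hf : Integrable f intervalMeasure) (s : ℝ) :
    Omega f s = omegaExt f s := by
  have h1 (σ : ℝ) : ∫ τ in (0 : ℝ)..σ, fhat f τ = omegaExt' f σ := by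
    rw [intervalIntegral.integral_eq_sub_of_hasDerivAt
      (fun x _ => (hasDerivAt_omegaExt' hf x).comp_ofReal)
      ((continuous_fhat_ofReal hf).intervalIntegrable _ _), Complex.ofReal_zero, omegaExt'_zero,
      sub_zero]
  simp only [Omega, h1]
  rw [intervalIntegral.integral_eq_sub_of_hasDerivAt
    (fun x _ => (hasDerivAt_omegaExt hf x).comp_ofReal)
    ((continuous_omegaExt'_ofReal hf).intervalIntegrable _ _), Complex.ofReal_zero, omegaExt_zero,
    sub_zero]

lemma hasDerivAt_Omega {f : ℝ → ℂ} (hf : Integrable f intervalMeasure) (s : ℝ) :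
    HasDerivAt (Omega f) (omegaExt' f s) s := by
  rw [funext (Omega_eq_omegaExt hf)]
  exact (hasDerivAt_omegaExt hf s).comp_ofReal

/-! ### Bounds on the real line -/

lemma norm_fhat_ofReal_le (f : ℝ → ℂ) (s : ℝ) :
    ‖fhat f s‖ ≤ ∫ t, ‖f t‖ ∂intervalMeasure := by
  rw [fhat_eq_setIntegral]
  refine (norm_integral_le_integral_norm _).trans_eq ?_
  simp only [norm_mul, norm_cexp_neg_I_mul, one_mul]

lemma integral_norm_le {f : ℝ → ℂ} (hf : MemLp f ∞ intervalMeasure) :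
    ∫ t, ‖f t‖ ∂intervalMeasure ≤ 2 * (eLpNorm f ∞ intervalMeasure).toReal := by
  have h : ∫ t, ‖f t‖ ∂intervalMeasure
      ≤ ∫ _, (eLpNorm f ∞ intervalMeasure).toReal ∂intervalMeasure :=
    integral_mono_ae (hf.integrable le_top).norm (integrable_const _)
      ((ae_restrict_iff' measurableSet_Icc).2 (ae_norm_le_of_memLp_top hf))
  refine h.trans_eq ?_
  rw [integral_const, measureReal_restrict_apply_univ, Real.volume_real_Icc]
  norm_num

lemma tendsto_fhat_cocompact (f : ℝ → ℂ) :
    Tendsto (fun s : ℝ => fhat f s) (cocompact ℝ) (𝓝 0) := by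
  have hc : (2 * Real.pi)⁻¹ ≠ 0 := by positivity
  -- Riemann–Lebesgue is stated for the kernel e^{−2πist}; the dilation by 1/(2π) converts it to
  -- e^{−ist}.
  have h := (Real.tendsto_integral_exp_smul_cocompact ((Set.Icc (-1 : ℝ) 1).indicator f)).comp
    (Homeomorph.mulRight₀ _ hc).isClosedEmbedding.tendsto_cocompact
  refine h.congr fun s => ?_
  rw [fhat_eq_setIntegral, ← integral_indicator measurableSet_Icc]
  refine integral_congr_ae (Eventually.of_forall fun t => ?_)
  simp only [Homeomorph.coe_mulRight₀]
  by_cases ht : t ∈ Set.Icc (-1 : ℝ) 1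
  · rw [Set.indicator_of_mem ht, Set.indicator_of_mem ht, Circle.smul_def, Real.fourierChar_apply,
      smul_eq_mul]
    congr 2
    push_cast
    field_simp
  · rw [Set.indicator_of_notMem ht, Set.indicator_of_notMem ht, smul_zero]

lemma norm_one_sub_cexp_neg (s t : ℝ) :
    ‖1 - Complex.exp (-Complex.I * s * t)‖ ≤ |s| * |t| := by
  rw [norm_sub_rev, show -Complex.I * s * t = Complex.I * ((-(s * t) : ℝ) : ℂ) by push_cast; ring]
  refine (Real.norm_exp_I_mul_ofReal_sub_one_le).trans_eq ?_
  rw [norm_neg, Real.norm_eq_abs, abs_mul]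

lemma norm_v'_ofReal_le (s t : ℝ) : ‖v' s t‖ ≤ |s| := by
  by_cases h0 : t = 0
  · simp [v', h0]
  · simp only [v', h0, if_false]
    rw [norm_div, norm_mul, norm_neg, Complex.norm_I, one_mul, Complex.norm_real, Real.norm_eq_abs,
      div_le_iff₀ (by positivity)]
    exact norm_one_sub_cexp_neg s t

lemma norm_v'_ofReal_le_div (s : ℝ) {t : ℝ} (h0 : t ≠ 0) : ‖v' s t‖ ≤ 2 / |t| := by
  simp only [v', h0, if_false]
  rw [norm_div, norm_mul, norm_neg, Complex.norm_I, one_mul, Complex.norm_real, Real.norm_eq_abs]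
  gcongr
  refine (norm_sub_le _ _).trans ?_
  rw [norm_cexp_neg_I_mul, norm_one]
  norm_num

lemma norm_omegaExt'_le {f : ℝ → ℂ} (hf : MemLp f ∞ intervalMeasure) (s : ℝ) :
    ‖omegaExt' f s‖ ≤ (eLpNorm f ∞ intervalMeasure).toReal * (2 * |s|) := by
  have hi := hf.integrable (q := ∞) le_top
  refine (norm_integral_le_of_norm_le (hi.norm.const_mul |s|)
    (Eventually.of_forall fun t => ?_)).trans ?_
  · rw [norm_mul]
    exact mul_le_mul_of_nonneg_right (norm_v'_ofReal_le s t) (norm_nonneg _)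
  · rw [integral_const_mul]
    have := mul_le_mul_of_nonneg_left (integral_norm_le hf) (abs_nonneg s)
    linarith

/-- Split at |t| = 1/|s|. Inside, |v'| ≤ |s| on a length 2/|s| contributes 2M; outside, |v'| ≤ 2/|t|
contributes 2M log|s| on each side. -/
lemma norm_omegaExt'_le_log {f : ℝ → ℂ} (hf : MemLp f ∞ intervalMeasure) {s : ℝ} (hs : 1 ≤ |s|) :
    ‖omegaExt' f s‖ ≤ (eLpNorm f ∞ intervalMeasure).toReal * (2 + 4 * Real.log |s|) := by
  set M := (eLpNorm f ∞ intervalMeasure).toReal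
  have hM0 : 0 ≤ M := ENNReal.toReal_nonneg
  have hM : ∀ᵐ t, t ∈ Set.Icc (-1 : ℝ) 1 → ‖f t‖ ≤ M := ae_norm_le_of_memLp_top hf
  have hi : Integrable f intervalMeasure := hf.integrable le_top
  set a := |s|⁻¹ with ha
  have ha0 : 0 < a := by positivity
  have ha1 : a ≤ 1 := inv_le_one_of_one_le₀ hs
  have hlog : Real.log a = -Real.log |s| := Real.log_inv _
  have hint : ∀ x y, -1 ≤ x → y ≤ 1 → x ≤ y →
      IntervalIntegrable (fun t => v' s t * f t) volume x y := fun x y hx hy hxy => by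
    rw [intervalIntegrable_iff_integrableOn_Icc_of_le hxy]
    exact IntegrableOn.mono_set (t := Set.Icc (-1 : ℝ) 1)
      (integrable_kernel_mul hi (measurable_v' s) fun t _ => norm_v'_ofReal_le s t)
      (Set.Icc_subset_Icc hx hy)
  have e : omegaExt' f s = (∫ t in (-1 : ℝ)..(-a), v' s t * f t)
      + (∫ t in (-a)..a, v' s t * f t) + ∫ t in a..1, v' s t * f t := by
    rw [omegaExt', ← intervalIntegral_eq_integral, intervalIntegral.integral_add_adjacent_intervals
      (hint _ _ le_rfl (by linarith) (by linarith)) (hint _ _ (by linarith) ha1 (by linarith)),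
      intervalIntegral.integral_add_adjacent_intervals
      (hint _ _ le_rfl ha1 (by linarith)) (hint _ _ (by linarith) le_rfl ha1)]
  have h0 : (0 : ℝ) ∉ Set.uIcc a 1 := by
    rw [Set.uIcc_of_le ha1]
    exact fun h => absurd h.1 (not_le.2 ha0)
  have h0' : (0 : ℝ) ∉ Set.uIcc (-1) (-a) := by
    rw [Set.uIcc_of_le (by linarith)]
    exact fun h => absurd h.2 (not_le.2 (by linarith))
  have b1 : ‖∫ t in (-1 : ℝ)..(-a), v' s t * f t‖ ≤ 2 * M * Real.log |s| := by
    have hI : IntervalIntegrable (fun t : ℝ => -2 * M * t⁻¹) volume (-1) (-a) :=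
      (intervalIntegral.intervalIntegrable_inv (fun t ht => ne_of_mem_of_not_mem ht h0')
        continuousOn_id).const_mul _
    refine (intervalIntegral.norm_integral_le_of_norm_le (by linarith) ?_ hI).trans_eq ?_
    · filter_upwards [hM] with t ht hmem
      have ht0 : t < 0 := by linarith [hmem.2]
      rw [norm_mul]
      refine (mul_le_mul (norm_v'_ofReal_le_div s ht0.ne) (ht ⟨hmem.1.le, by linarith⟩)
        (norm_nonneg _) (by positivity)).trans_eq ?_
      rw [abs_of_neg ht0]
      field_simp
    · rw [intervalIntegral.integral_const_mul, integral_inv h0', neg_div_neg_eq, div_one, hlog]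
      ring
  have b2 : ‖∫ t in (-a)..a, v' s t * f t‖ ≤ 2 * M := by
    refine (intervalIntegral.norm_integral_le_of_norm_le (g := fun _ => |s| * M) (by linarith) ?_
      (by simp)).trans_eq ?_
    · filter_upwards [hM] with t ht hmem
      rw [norm_mul]
      exact mul_le_mul (norm_v'_ofReal_le s t) (ht ⟨by linarith [hmem.1], by linarith [hmem.2]⟩)
        (norm_nonneg _) (abs_nonneg s)
    · rw [intervalIntegral.integral_const, smul_eq_mul, ha]
      have : |s| ≠ 0 := by positivity
      field_simp
      ring
  have b3 : ‖∫ t in a..1, v' s t * f t‖ ≤ 2 * M * Real.log |s| := by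
    have hI : IntervalIntegrable (fun t : ℝ => 2 * M * t⁻¹) volume a 1 :=
      (intervalIntegral.intervalIntegrable_inv (fun t ht => ne_of_mem_of_not_mem ht h0)
        continuousOn_id).const_mul _
    refine (intervalIntegral.norm_integral_le_of_norm_le ha1 ?_ hI).trans_eq ?_
    · filter_upwards [hM] with t ht hmem
      have ht0 : 0 < t := by linarith [hmem.1]
      rw [norm_mul]
      refine (mul_le_mul (norm_v'_ofReal_le_div s ht0.ne') (ht ⟨by linarith, hmem.2⟩)
        (norm_nonneg _) (by positivity)).trans_eq ?_
      rw [abs_of_pos ht0]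
      field_simp
    · rw [intervalIntegral.integral_const_mul, integral_inv h0, Real.log_div one_ne_zero ha0.ne',
        Real.log_one, hlog]
      ring
  rw [e]
  refine (norm_add₃_le).trans ?_
  linarith

lemma norm_omegaExt'_sub_le {f : ℝ → ℂ} (hf : MemLp f ∞ intervalMeasure) (s σ : ℝ) :
    ‖omegaExt' f σ - omegaExt' f s‖ ≤ 2 * (eLpNorm f ∞ intervalMeasure).toReal * |σ - s| := by
  have hi : Integrable f intervalMeasure := hf.integrable le_top
  exact convex_univ.norm_image_sub_le_of_norm_hasDerivWithin_le (f := fun s : ℝ => omegaExt' f s)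
    (fun x _ => (hasDerivAt_omegaExt' hi x).comp_ofReal.hasDerivWithinAt)
    (fun x _ => (norm_fhat_ofReal_le f x).trans (integral_norm_le hf)) (Set.mem_univ s)
    (Set.mem_univ σ)

/-- Taylor's formula with the second derivative bounded by 2M, where M is the sup norm of f; hence
the remainder M h². -/
lemma norm_Omega_add_sub_le {f : ℝ → ℂ} (hf : MemLp f ∞ intervalMeasure) (s h : ℝ) :
    ‖Omega f (s + h) - Omega f s‖ ≤
      |h| * ‖omegaExt' f s‖ + (eLpNorm f ∞ intervalMeasure).toReal * h ^ 2 := by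
  have hi : Integrable f intervalMeasure := hf.integrable le_top
  set M := (eLpNorm f ∞ intervalMeasure).toReal
  -- The segment from s to s + h is parametrised by [0, 1], so the sign of h plays no role; the
  -- linear part is subtracted beforehand.
  have hder : ∀ x ∈ Set.uIcc (0 : ℝ) 1, HasDerivAt
      (fun x : ℝ => Omega f (s + x * h) - x * (h * omegaExt' f s))
      (h * (omegaExt' f (s + x * h : ℝ) - omegaExt' f s)) x := fun x _ => by
    have h1 : HasDerivAt (fun x : ℝ => s + x * h) h x := by
      simpa using ((hasDerivAt_id x).mul_const h).const_add s
    have h2 : HasDerivAt (fun x : ℝ => (x : ℂ) * (h * omegaExt' f s)) (h * omegaExt' f s) x := by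
      simpa using (hasDerivAt_id x).ofReal_comp.mul_const (h * omegaExt' f s)
    refine (((hasDerivAt_Omega hi (s + x * h)).scomp x h1).sub h2).congr_deriv ?_
    rw [Complex.real_smul]
    ring
  have hcont : Continuous fun x : ℝ =>
      (h : ℂ) * (omegaExt' f (s + x * h : ℝ) - omegaExt' f s) :=
    continuous_const.mul (((continuous_omegaExt'_ofReal hi).comp
      (f := fun x : ℝ => s + x * h) (by fun_prop)).sub continuous_const)
  have hFTC := intervalIntegral.integral_eq_sub_of_hasDerivAt hder (hcont.intervalIntegrable _ _)
  simp only [one_mul, zero_mul, add_zero, sub_zero, Complex.ofReal_one, Complex.ofReal_zero] at hFTC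
  have hI : ∫ x in (0 : ℝ)..1, 2 * M * h ^ 2 * x = M * h ^ 2 := by
    rw [intervalIntegral.integral_const_mul, integral_id]
    ring
  have hbound : ‖∫ x in (0 : ℝ)..1, (h : ℂ) * (omegaExt' f (s + x * h : ℝ) - omegaExt' f s)‖
      ≤ M * h ^ 2 := by
    rw [← hI]
    refine intervalIntegral.norm_integral_le_of_norm_le zero_le_one
      (Eventually.of_forall fun x hx => ?_)
      (Continuous.intervalIntegrable (by fun_prop) _ _)
    rw [norm_mul, Complex.norm_real, Real.norm_eq_abs]
    refine (mul_le_mul_of_nonneg_left (norm_omegaExt'_sub_le hf s (s + x * h))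
      (abs_nonneg h)).trans_eq ?_
    rw [add_sub_cancel_left, abs_mul, abs_of_pos hx.1, ← sq_abs h]
    ring
  have e : Omega f (s + h) - Omega f s = h * omegaExt' f s +
      ∫ x in (0 : ℝ)..1, (h : ℂ) * (omegaExt' f (s + x * h : ℝ) - omegaExt' f s) := by
    rw [hFTC]
    ring
  rw [e]
  refine (norm_add_le _ _).trans (add_le_add ?_ hbound)
  rw [norm_mul, Complex.norm_real, Real.norm_eq_abs]

/-- The mean value inequality from 0 to s: the derivative bound at |s| also covers all smaller |x|,
including |x| ≤ 1 where the linear bound is used. -/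
lemma norm_Omega_le {f : ℝ → ℂ} (hf : MemLp f ∞ intervalMeasure) {s : ℝ} (hs : 1 ≤ |s|) :
    ‖Omega f s‖ ≤ (eLpNorm f ∞ intervalMeasure).toReal * (2 + 4 * Real.log |s|) * |s| := by
  have hi : Integrable f intervalMeasure := hf.integrable le_top
  have h := (convex_Icc (-|s|) |s|).norm_image_sub_le_of_norm_hasDerivWithin_le
    (C := (eLpNorm f ∞ intervalMeasure).toReal * (2 + 4 * Real.log |s|))
    (fun x _ => (hasDerivAt_Omega hi x).hasDerivWithinAt) (fun x hx => ?_)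
    (⟨by simp, abs_nonneg s⟩ : (0 : ℝ) ∈ Set.Icc (-|s|) |s|)
    (⟨neg_abs_le s, le_abs_self s⟩ : s ∈ Set.Icc (-|s|) |s|)
  · have h0 : Omega f 0 = 0 := by simp [Omega]
    simpa [h0] using h
  · have hx' : |x| ≤ |s| := abs_le.2 hx
    have hlog : 0 ≤ Real.log |s| := Real.log_nonneg hs
    rcases le_total |x| 1 with h1 | h1
    · refine (norm_omegaExt'_le hf x).trans ?_
      refine mul_le_mul_of_nonneg_left ?_ ENNReal.toReal_nonneg
      linarith
    · refine (norm_omegaExt'_le_log hf h1).trans ?_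
      refine mul_le_mul_of_nonneg_left ?_ ENNReal.toReal_nonneg
      have := Real.log_le_log (by linarith) hx'
      linarith

lemma Omega_isBigO {f : ℝ → ℂ} (hf : MemLp f ∞ intervalMeasure) :
    Omega f =O[cocompact ℝ] fun s : ℝ => s * Real.log |s| := by
  -- For |s| ≥ e one has log|s| ≥ 1, so 2 + 4 log|s| ≤ 6 log|s|.
  refine IsBigO.of_bound (6 * (eLpNorm f ∞ intervalMeasure).toReal) ?_
  filter_upwards [(tendsto_norm_cocompact_atTop (E := ℝ)).eventually_ge_atTop (Real.exp 1)]
    with s hs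
  rw [Real.norm_eq_abs] at hs
  have hs1 : 1 ≤ |s| := (Real.one_le_exp zero_le_one).trans hs
  have hlog : 1 ≤ Real.log |s| := (Real.le_log_iff_exp_le (by linarith)).2 hs
  refine (norm_Omega_le hf hs1).trans ?_
  rw [norm_mul, Real.norm_eq_abs, Real.norm_of_nonneg (by linarith)]
  have hM : 0 ≤ (eLpNorm f ∞ intervalMeasure).toReal := ENNReal.toReal_nonneg
  have : 2 + 4 * Real.log |s| ≤ 6 * Real.log |s| := by linarith
  calc _ ≤ (eLpNorm f ∞ intervalMeasure).toReal * (6 * Real.log |s|) * |s| := by gcongr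
    _ = _ := by ring

/-! ### Sharpness of the growth estimate -/

/-- The sign function, for which the growth `s log |s|` is attained. -/
def signFun (t : ℝ) : ℂ := if t < 0 then -1 else 1

lemma measurable_signFun : Measurable signFun :=
  Measurable.ite measurableSet_Iio measurable_const measurable_const

lemma norm_signFun (t : ℝ) : ‖signFun t‖ = 1 := by
  unfold signFun
  split_ifs <;> simp

lemma memLp_signFun : MemLp signFun ∞ intervalMeasure :=
  memLp_top_of_bound measurable_signFun.aestronglyMeasurable 1
    (Eventually.of_forall fun t => (norm_signFun t).le)

lemma im_v_ofReal (s : ℝ) {t : ℝ} (ht : t ≠ 0) :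
    (v s t).im = (Real.sin (s * t) - s * t) / t ^ 2 := by
  have e : Complex.exp (-Complex.I * s * t)
      = (Real.cos (s * t) : ℂ) - (Real.sin (s * t) : ℂ) * Complex.I := by
    rw [show -Complex.I * s * t = ((-(s * t) : ℝ) : ℂ) * Complex.I by push_cast; ring,
      Complex.exp_mul_I, ← Complex.ofReal_cos, ← Complex.ofReal_sin, Real.cos_neg, Real.sin_neg]
    push_cast
    ring
  have e2 : v s t = (((1 - Real.cos (s * t)) / t ^ 2 : ℝ) : ℂ)
      + (((Real.sin (s * t) - s * t) / t ^ 2 : ℝ) : ℂ) * Complex.I := by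
    simp only [v, ht, if_false]
    rw [e]
    push_cast
    ring
  rw [e2, Complex.add_im, Complex.ofReal_im, Complex.im_ofReal_mul, Complex.I_im]
  ring

/-- Im v is odd in t, and the sign function compensates the oddness, so sin x ≤ x for x ≥ 0 settles
both half-lines. -/
lemma neg_im_v_mul_signFun_nonneg {s : ℝ} (hs : 0 ≤ s) (t : ℝ) :
    0 ≤ -(v s t * signFun t).im := by
  rcases lt_trichotomy t 0 with ht | rfl | ht
  · have h1 : Real.sin (s * -t) ≤ s * -t := Real.sin_le (mul_nonneg hs (by linarith))
    have e : -(v s t * signFun t).im = (v s t).im := by simp [signFun, ht]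
    rw [e, im_v_ofReal s ht.ne]
    refine div_nonneg ?_ (sq_nonneg t)
    rw [mul_neg, Real.sin_neg] at h1
    linarith
  · simp [v, signFun, ← Complex.ofReal_pow]
  · have e : -(v s t * signFun t).im = -(v s t).im := by simp [signFun, not_lt.2 ht.le]
    rw [e, im_v_ofReal s ht.ne', ← neg_div]
    have := Real.sin_le (mul_nonneg hs ht.le)
    exact div_nonneg (by linarith) (sq_nonneg t)

/-- For st ≥ 2, sin(st) ≤ 1 ≤ st/2, so at least half of st survives in st − sin(st). -/
lemma le_neg_im_v_mul_signFun {s t : ℝ} (hs : 0 < s) (ht : 2 / s ≤ t) :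
    s / 2 * (1 / t) ≤ -(v s t * signFun t).im := by
  have ht0 : 0 < t := lt_of_lt_of_le (by positivity) ht
  have e : -(v s t * signFun t).im = -(v s t).im := by simp [signFun, not_lt.2 ht0.le]
  rw [e, im_v_ofReal s ht0.ne', ← neg_div, le_div_iff₀ (by positivity)]
  have h1 := Real.sin_le_one (s * t)
  rw [div_le_iff₀ hs] at ht
  have e2 : s / 2 * (1 / t) * t ^ 2 = s * t / 2 := by field_simp
  rw [e2]
  linarith

lemma le_norm_Omega_signFun {s : ℝ} (hs : 4 ≤ s) :
    1 / 4 * (s * Real.log s) ≤ ‖Omega signFun s‖ := by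
  have hs0 : 0 < s := by linarith
  have hi : Integrable signFun intervalMeasure := memLp_signFun.integrable le_top
  have hk : Integrable (fun t => v s t * signFun t) intervalMeasure :=
    integrable_kernel_mul hi (measurable_v s) fun t ht => norm_v_le s ht
  have hneg : Integrable (fun t => -(v s t * signFun t).im) intervalMeasure := hk.im.neg
  have h2s : 2 / s ≤ 1 := by rw [div_le_one hs0]; linarith
  have h2s0 : 0 < 2 / s := by positivity
  have hsub : Set.Icc (2 / s) 1 ⊆ Set.Icc (-1 : ℝ) 1 := Set.Icc_subset_Icc (by linarith) le_rfl
  have h0 : (0 : ℝ) ∉ Set.uIcc (2 / s) 1 := by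
    rw [Set.uIcc_of_le h2s]
    exact fun h => absurd h.1 (not_le.2 h2s0)
  have hI : IntegrableOn (fun t : ℝ => s / 2 * (1 / t)) (Set.Icc (2 / s) 1) := by
    exact ContinuousOn.integrableOn_Icc (continuousOn_const.mul
      (continuousOn_const.div continuousOn_id fun t ht => (h2s0.trans_le ht.1).ne'))
  have e : ∫ t in Set.Icc (2 / s) 1, s / 2 * (1 / t) = s / 2 * Real.log (s / 2) := by
    rw [integral_Icc_eq_integral_Ioc, ← intervalIntegral.integral_of_le h2s,
      intervalIntegral.integral_const_mul, integral_one_div h0, one_div_div]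
  -- Equivalent to s ≤ (s/2)², which is where s ≥ 4 enters.
  have hlog : Real.log s ≤ 2 * Real.log (s / 2) := by
    rw [← Real.log_rpow (by positivity), Real.rpow_two]
    exact Real.log_le_log hs0 (by nlinarith)
  calc 1 / 4 * (s * Real.log s) ≤ s / 2 * Real.log (s / 2) := by nlinarith
    _ = ∫ t in Set.Icc (2 / s) 1, s / 2 * (1 / t) := e.symm
    _ ≤ ∫ t in Set.Icc (2 / s) 1, -(v s t * signFun t).im :=
        setIntegral_mono_on hI (IntegrableOn.mono_set (t := Set.Icc (-1 : ℝ) 1) hneg hsub)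
          measurableSet_Icc fun t ht => le_neg_im_v_mul_signFun hs0 ht.1
    _ ≤ ∫ t, -(v s t * signFun t).im ∂intervalMeasure :=
        setIntegral_mono_set hneg
          (Eventually.of_forall fun t => neg_im_v_mul_signFun_nonneg hs0.le t)
          hsub.eventuallyLE
    _ = -(Omega signFun s).im := by
        rw [integral_neg, Omega_eq_omegaExt hi, omegaExt]
        congr 1
        exact integral_im hk
    _ ≤ ‖Omega signFun s‖ := (neg_le_abs _).trans (Complex.abs_im_le_norm _)

lemma Omega_signFun_not_isLittleO :
    ¬ (Omega signFun) =o[cocompact ℝ] fun s : ℝ => s * Real.log |s| := fun h => by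
  have h1 := (h.def (by norm_num : (0 : ℝ) < 1 / 8)).filter_mono atTop_le_cocompact
  obtain ⟨s, hs, h4⟩ := (h1.and (eventually_ge_atTop (4 : ℝ))).exists
  have hlog : 0 < Real.log s := Real.log_pos (by linarith)
  have hpos : 0 < s * Real.log s := mul_pos (by linarith) hlog
  rw [abs_of_pos (by linarith : 0 < s), Real.norm_of_nonneg hpos.le] at hs
  have := le_norm_Omega_signFun h4
  linarith

/-! ### The sup bound and the Hausdorff-Young inequality with extended exponents -/

lemma eLpNorm_fhat_top_le {f : ℝ → ℂ} (hf : Integrable f intervalMeasure) :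
    eLpNorm (fun s : ℝ => fhat f (s : ℂ)) ∞ volume ≤ eLpNorm f 1 intervalMeasure := by
  rw [eLpNorm_exponent_top]
  refine eLpNormEssSup_le_of_ae_enorm_bound (Eventually.of_forall fun s => ?_)
  rw [eLpNorm_one_eq_lintegral_enorm, ← ofReal_integral_norm_eq_lintegral_enorm hf, ← ofReal_norm]
  exact ENNReal.ofReal_le_ofReal (norm_fhat_ofReal_le f s)

lemma eLpNorm_fhat_le_of_conjugate {f : ℝ → ℂ} (hf : MemLp f ∞ intervalMeasure) {p q : ℝ≥0∞}
    (hp1 : 1 ≤ p) (hp2 : p ≤ 2) (hpq : p⁻¹ + q⁻¹ = 1) :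
    eLpNorm (fun s : ℝ => fhat f (s : ℂ)) q volume
      ≤ ENNReal.ofReal (hausdorffYoungConst p.toReal) * eLpNorm f p intervalMeasure := by
  rcases hp1.eq_or_lt with rfl | hp1
  · have hq : q = ∞ := by
      rw [inv_one] at hpq
      have : q⁻¹ = 0 := by
        refine (ENNReal.add_right_inj ENNReal.one_ne_top).1 ?_
        rw [hpq, add_zero]
      exact ENNReal.inv_eq_zero.1 this
    rw [hq, ENNReal.toReal_one, hausdorffYoungConst_one, ENNReal.ofReal_one, one_mul]
    exact eLpNorm_fhat_top_le (hf.integrable le_top)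
  · have hptop : p ≠ ∞ := ne_top_of_le_ne_top (by norm_num) hp2
    have hp0 : p ≠ 0 := (zero_lt_one.trans hp1).ne'
    have hqtop : q ≠ ∞ := fun h => by
      rw [h, ENNReal.inv_top, add_zero, ENNReal.inv_eq_one] at hpq
      exact hp1.ne' hpq
    have hq0 : q ≠ 0 := fun h => by
      rw [h, ENNReal.inv_zero, add_top] at hpq
      exact ENNReal.top_ne_one hpq
    have hp1' : 1 < p.toReal := by
      rw [← ENNReal.toReal_one]
      exact (ENNReal.toReal_lt_toReal ENNReal.one_ne_top hptop).2 hp1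
    have hp2' : p.toReal ≤ 2 := by
      simpa using ENNReal.toReal_mono (by norm_num) hp2
    have hq' : 0 < q.toReal := ENNReal.toReal_pos hq0 hqtop
    have hpq' : p.toReal⁻¹ + q.toReal⁻¹ = 1 := by
      rw [← ENNReal.toReal_inv, ← ENNReal.toReal_inv, ← ENNReal.toReal_add
        (ENNReal.inv_ne_top.2 hp0) (ENNReal.inv_ne_top.2 hq0), hpq, ENNReal.toReal_one]
    have h := eLpNorm_fhat_le hf hp1' hp2' (q := q.toReal) (by
      field_simp at hpq'
      linarith)
    rwa [ENNReal.ofReal_toReal hptop, ENNReal.ofReal_toReal hqtop] at h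

end BoundedFourier

end

/-! ### The assembled theorem -/

theorem mainTheorem8 :
    (∀ f : ℝ → ℂ, MemLp f ∞ BoundedFourier.intervalMeasure →
      -- (a) boundedness
      eLpNorm (fun s : ℝ => BoundedFourier.fhat f (s : ℂ)) ∞ volume
          ≤ eLpNorm f 1 BoundedFourier.intervalMeasure ∧
      -- (b) Hausdorff-Young-Babenko-Beckner
      (∀ p q : ℝ≥0∞, 1 ≤ p → p ≤ 2 → p⁻¹ + q⁻¹ = 1 →
        MemLp f p BoundedFourier.intervalMeasure ∧
        eLpNorm (fun s : ℝ => BoundedFourier.fhat f (s : ℂ)) q volume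
          ≤ ENNReal.ofReal (BoundedFourier.hausdorffYoungConst p.toReal)
            * eLpNorm f p BoundedFourier.intervalMeasure) ∧
      -- (c) Riemann-Lebesgue
      Tendsto (fun s : ℝ => BoundedFourier.fhat f (s : ℂ)) (cocompact ℝ) (𝓝 0) ∧
      -- (d) the transform is entire
      AnalyticOnNhd ℂ (BoundedFourier.fhat f) Set.univ ∧
      -- (e) kernel representation, entire extension, second derivative (on the line and on the plane)
      (∀ s : ℝ, BoundedFourier.Omega f s
        = ∫ t in (-1 : ℝ)..1, BoundedFourier.v (s : ℂ) t * f t) ∧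
      AnalyticOnNhd ℂ (fun z : ℂ => ∫ t in (-1 : ℝ)..1, BoundedFourier.v z t * f t) Set.univ ∧
      (∃ Ω' : ℝ → ℂ, (∀ s : ℝ, HasDerivAt (BoundedFourier.Omega f) (Ω' s) s) ∧
        ∀ s : ℝ, HasDerivAt Ω' (BoundedFourier.fhat f (s : ℂ)) s) ∧
      (∀ z : ℂ, deriv (deriv (fun w : ℂ => ∫ t in (-1 : ℝ)..1, BoundedFourier.v w t * f t)) z
        = BoundedFourier.fhat f z) ∧
      -- (f) growth
      (BoundedFourier.Omega f) =O[cocompact ℝ] (fun s : ℝ => s * Real.log |s|) ∧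
      -- (g) increments
      (∀ s h : ℝ,
        (|s| ≤ 1 → ‖BoundedFourier.Omega f (s + h) - BoundedFourier.Omega f s‖
          ≤ (eLpNorm f ∞ BoundedFourier.intervalMeasure).toReal * (2 * |h| * |s| + h ^ 2)) ∧
        (1 ≤ |s| → ‖BoundedFourier.Omega f (s + h) - BoundedFourier.Omega f s‖
          ≤ (eLpNorm f ∞ BoundedFourier.intervalMeasure).toReal
            * (2 * |h| + 4 * |h| * Real.log |s| + h ^ 2)))) ∧
    -- (f) sharpness of the growth estimate
    (∃ f : ℝ → ℂ, MemLp f ∞ BoundedFourier.intervalMeasure ∧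
      ¬ (BoundedFourier.Omega f) =o[cocompact ℝ] (fun s : ℝ => s * Real.log |s|)) := by
  refine ⟨fun f hf => ?_, BoundedFourier.signFun, BoundedFourier.memLp_signFun,
    BoundedFourier.Omega_signFun_not_isLittleO⟩
  have hi : Integrable f BoundedFourier.intervalMeasure := hf.integrable le_top
  have hext : (fun z : ℂ => ∫ t in (-1 : ℝ)..1, BoundedFourier.v z t * f t)
      = BoundedFourier.omegaExt f :=
    funext fun z => BoundedFourier.intervalIntegral_eq_integral _
  rw [hext]
  refine ⟨BoundedFourier.eLpNorm_fhat_top_le hi, fun p q hp1 hp2 hpq =>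
    ⟨hf.mono_exponent le_top, BoundedFourier.eLpNorm_fhat_le_of_conjugate hf hp1 hp2 hpq⟩,
    BoundedFourier.tendsto_fhat_cocompact f, fun z _ =>
    (BoundedFourier.differentiable_fhat hi).analyticAt z, fun s => ?_, fun z _ => ?_,
    ⟨fun s => BoundedFourier.omegaExt' f s, BoundedFourier.hasDerivAt_Omega hi,
      fun s => (BoundedFourier.hasDerivAt_omegaExt' hi s).comp_ofReal⟩, fun z => ?_,
    BoundedFourier.Omega_isBigO hf, fun s h => ⟨fun hs => ?_, fun hs => ?_⟩⟩
  · rw [BoundedFourier.Omega_eq_omegaExt hi]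
    exact (BoundedFourier.intervalIntegral_eq_integral _).symm
  · exact Differentiable.analyticAt
      (fun w => (BoundedFourier.hasDerivAt_omegaExt hi w).differentiableAt) z
  · rw [funext fun w => (BoundedFourier.hasDerivAt_omegaExt hi w).deriv]
    exact (BoundedFourier.hasDerivAt_omegaExt' hi z).deriv
  · refine (BoundedFourier.norm_Omega_add_sub_le hf s h).trans ?_
    have := mul_le_mul_of_nonneg_left (BoundedFourier.norm_omegaExt'_le hf s) (abs_nonneg h)
    linarith
  · refine (BoundedFourier.norm_Omega_add_sub_le hf s h).trans ?_
    have := mul_le_mul_of_nonneg_left (BoundedFourier.norm_omegaExt'_le_log hf hs) (abs_nonneg h)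
    linarith
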